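/- Let $\mathcal H$ be a separable complex Hilbert space, and write $\mathcal B(\mathcal H)_{\gneq 0}$ for the set of non-zero positive semi-definite (PSD) bounded operators on $\mathcal H$. For a bounded PSD operator $A$, let $A^p$ ($p>0$) be defined by functional calculus, let $A^0$ be the orthogonal projection onto $(\ker A)^\perp$, and let $\operatorname{Tr}A\in[0,+\infty]$ be the trace. For $\varrho,\sigma\in\mathcal B(\mathcal H)_{\gneq 0}$, $\alpha\in(1,+\infty)$ and $z\in(0,+\infty)$ put \[ \mathcal B^{\alpha,z}(\mathcal H,\sigma):=\Big\{\varrho\in\mathcal B(\mathcal H)_{\gneq 0}:\ \exists R\in\mathcal B(\mathcal H)\text{ such that }\varrho^{\frac{\alpha}{z}}=\sigma^{\frac{\alpha-1}{2z}}R\,\sigma^{\frac{\alpha-1}{2z}}\Big\}. \] For $\varrho\in\mathcal B^{\alpha,z}(\mathcal H,\sigma)$ there is a unique PSD operator $R=:\varrho_{\sigma,\alpha,z}$ with this property and $R^0\le\sigma^0$. Define \[ Q_{\alpha,z}(\varrho\|\sigma):=\begin{cases}\operatorname{Tr}\varrho_{\sigma,\alpha,z}^{\,z},&\varrho\in\mathcal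 B^{\alpha,z}(\mathcal H,\sigma),\\+\infty,&\text{otherwise,}\end{cases} \qquad D_{\alpha,z}(\varrho\|\sigma):=\frac{1}{\alpha-1}\log Q_{\alpha,z}(\varrho\|\sigma), \] \[ \mathcal L^{\alpha,z}(\mathcal H,\sigma):=\big\{\varrho\in\mathcal B^{\alpha,z}(\mathcal H,\sigma):\ \operatorname{Tr}\varrho_{\sigma,\alpha,z}^{\,z}<+\infty\big\}, \] and, when $\operatorname{Tr}\varrho<+\infty$, $\tilde D_{\alpha,z}(\varrho\|\sigma):=D_{\alpha,z}(\varrho\|\sigma)-\frac{1}{\alpha-1}\log\operatorname{Tr}\varrho$. Let $\alpha\in(1,+\infty)$. Then: 1. For all $\varrho,\sigma\in\mathcal B(\mathcal H)_{\gneq 0}$, the functions $z\mapsto Q_{\alpha,z}(\varrho\|\sigma)$ and $z\mapsto D_{\alpha,z}(\varrho\|\sigma)$ are (not necessarily strictly) decreasing on $(0,+\infty)$; if moreover $\operatorname{Tr}\varrho<+\infty$, then so is $z\mapsto\tilde D_{\alpha,z}(\varrho\|\sigma)$. 2. For every $\sigma\in\mathcal B(\mathcal H)_{\gneq 0}$ and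 all $0<z\le z'$, $\mathcal L^{\alpha,z}(\mathcal H,\sigma)\subseteq\mathcal L^{\alpha,z'}(\mathcal H,\sigma)$. 3. For all $\varrho,\sigma\in\mathcal B(\mathcal H)_{\gneq 0}$, the sandwiched Rényi divergence is at most the Petz-type Rényi divergence: $D_{\alpha,\alpha}(\varrho\|\sigma)\le D_{\alpha,1}(\varrho\|\sigma)$. -/

import Mathlib

open scoped ENNReal NNReal

namespace RenyiAZ

section Definitions

variable {H : Type*} [NormedAddCommGroup H] [InnerProductSpace ℂ H] [CompleteSpace H]

/-- The set `B(H)_{⪈ 0}` of non-zero positive semi-definite bounded operators on `H`. -/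
def nonzeroPSD (H : Type*) [NormedAddCommGroup H] [InnerProductSpace ℂ H] [CompleteSpace H] :
    Set (H →L[ℂ] H) :=
  {A | 0 ≤ A ∧ A ≠ 0}

/-- The support projection `A⁰` of a PSD operator `A`: the orthogonal projection onto
`(ker A)ᗮ`, which is the closure of the range of `A`. -/
noncomputable def supp (A : H →L[ℂ] H) : H →L[ℂ] H :=
  (A.ker)ᗮ.starProjection

/-- The trace of a PSD operator, with values in `[0, ∞]`, computed in some Hilbert basis
(see `trace_eq` for the independence of the basis). -/
noncomputable def trace (A : H →L[ℂ] H) : ℝ≥0∞ :=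
  ∑' i, ENNReal.ofReal
    (inner ℂ ((exists_hilbertBasis ℂ H).choose_spec.choose i)
      (A ((exists_hilbertBasis ℂ H).choose_spec.choose i))).re

/-- The operator `R` satisfies `ρ ^ (α / z) = σ ^ ((α - 1) / (2 z)) R σ ^ ((α - 1) / (2 z))`.
For `1 < α` and `0 < z` all exponents are positive. -/
def Factorizes (α z : ℝ) (ρ σ R : H →L[ℂ] H) : Prop :=
  ρ ^ (α / z) = σ ^ ((α - 1) / (2 * z)) * R * σ ^ ((α - 1) / (2 * z))

/-- The set `B^{α,z}(H, σ)`. -/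
def boundedSet (α z : ℝ) (σ : H →L[ℂ] H) : Set (H →L[ℂ] H) :=
  {ρ | ρ ∈ nonzeroPSD H ∧ ∃ R : H →L[ℂ] H, Factorizes α z ρ σ R}

open Classical in
/-- The operator `ρ_{σ,α,z}`: the unique PSD operator `R` with `R⁰ ≤ σ⁰` and
`ρ ^ (α / z) = σ ^ ((α - 1) / (2 z)) R σ ^ ((α - 1) / (2 z))`. It exists for every
`ρ ∈ B^{α,z}(H, σ)` by `existsUnique_sandwich`, and is set to `0` otherwise. -/
noncomputable def sandwich (α z : ℝ) (ρ σ : H →L[ℂ] H) : H →L[ℂ] H :=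
  if h : ∃ R : H →L[ℂ] H, 0 ≤ R ∧ supp R ≤ supp σ ∧ Factorizes α z ρ σ R then h.choose else 0

/-- The set `L^{α,z}(H, σ)`. -/
def finiteSet (α z : ℝ) (σ : H →L[ℂ] H) : Set (H →L[ℂ] H) :=
  {ρ | ρ ∈ boundedSet α z σ ∧ trace (sandwich α z ρ σ ^ z) < ∞}

open Classical in
/-- The quantity `Q_{α,z}(ρ‖σ) ∈ [0, ∞]`. -/
noncomputable def Q (α z : ℝ) (ρ σ : H →L[ℂ] H) : ℝ≥0∞ :=
  if ρ ∈ boundedSet α z σ then trace (sandwich α z ρ σ ^ z) else ∞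

/-- The Rényi `(α,z)`-divergence `D_{α,z}(ρ‖σ) = (α - 1)⁻¹ log Q_{α,z}(ρ‖σ)`,
with `log 0 = -∞` and `log ∞ = ∞`. -/
noncomputable def D (α z : ℝ) (ρ σ : H →L[ℂ] H) : EReal :=
  ((1 / (α - 1) : ℝ) : EReal) * ENNReal.log (Q α z ρ σ)

/-- The variant `D̃_{α,z}(ρ‖σ) = D_{α,z}(ρ‖σ) - (α - 1)⁻¹ log Tr ρ`, for `ρ` of finite trace. -/
noncomputable def Dtilde (α z : ℝ) (ρ σ : H →L[ℂ] H) : EReal :=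
  D α z ρ σ - ((1 / (α - 1) : ℝ) : EReal) * ENNReal.log (trace ρ)

/-- The sandwiched Rényi `α`-divergence. -/
noncomputable def Dsandwiched (α : ℝ) (ρ σ : H →L[ℂ] H) : EReal := D α α ρ σ

/-- The Petz-type Rényi `α`-divergence. -/
noncomputable def Dpetz (α : ℝ) (ρ σ : H →L[ℂ] H) : EReal := D α 1 ρ σ

end Definitions

section WellDefined

variable {H : Type*} [NormedAddCommGroup H] [InnerProductSpace ℂ H] [CompleteSpace H]

theorem parseval {ι : Type*} (e : HilbertBasis ι ℂ H) (x : H) :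
    ENNReal.ofReal (‖x‖ ^ 2) = ∑' i, ENNReal.ofReal (‖inner ℂ (e i) x‖ ^ 2) := by
  have h := e.hasSum_inner_mul_inner x x
  have h2 : HasSum (fun i => ‖inner ℂ (e i) x‖ ^ 2) (‖x‖ ^ 2) := by
    have h3 := Complex.hasSum_re h
    convert h3 using 1
    · ext i
      rw [← inner_conj_symm x (e i), mul_comm, Complex.mul_conj, Complex.normSq_eq_norm_sq,
        Complex.ofReal_re]
    · rw [inner_self_eq_norm_sq_to_K]
      simp [← Complex.ofReal_pow]
  rw [← h2.tsum_eq, ENNReal.ofReal_tsum_of_nonneg (fun _ => by positivity) h2.summable]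

/-- The trace of `A* A` in one basis equals that of `A A*` in another. -/
theorem tsum_norm_sq_eq {ι κ : Type*} (b : HilbertBasis ι ℂ H) (c : HilbertBasis κ ℂ H)
    (A : H →L[ℂ] H) :
    ∑' i, ENNReal.ofReal (‖A (b i)‖ ^ 2) =
      ∑' j, ENNReal.ofReal (‖ContinuousLinearMap.adjoint A (c j)‖ ^ 2) := by
  calc ∑' i, ENNReal.ofReal (‖A (b i)‖ ^ 2)
      = ∑' i, ∑' j, ENNReal.ofReal (‖inner ℂ (c j) (A (b i))‖ ^ 2) :=
        tsum_congr fun i => parseval c _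
    _ = ∑' j, ∑' i, ENNReal.ofReal (‖inner ℂ (c j) (A (b i))‖ ^ 2) := ENNReal.tsum_comm
    _ = _ := by
        refine tsum_congr fun j => ?_
        rw [parseval b]
        refine tsum_congr fun i => ?_
        rw [ContinuousLinearMap.adjoint_inner_right, norm_inner_symm]

/-- The trace of a PSD operator may be computed in any Hilbert basis. -/
theorem trace_eq {ι : Type*} (b : HilbertBasis ι ℂ H) {A : H →L[ℂ] H} (hA : 0 ≤ A) :
    trace A = ∑' i, ENNReal.ofReal (inner ℂ (b i) (A (b i))).re := by
  set S := CFC.sqrt A with hS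
  have hS0 : 0 ≤ S := CFC.sqrt_nonneg A
  have hSa : ContinuousLinearMap.adjoint S = S :=
    (IsSelfAdjoint.of_nonneg hS0).star_eq
  have key : ∀ x : H, (inner ℂ x (A x)).re = ‖S x‖ ^ 2 := by
    intro x
    conv_lhs => rw [← CFC.sqrt_mul_sqrt_self A hA]
    rw [← hS, mul_apply_eq_comp, ← ContinuousLinearMap.adjoint_inner_left, hSa,
      inner_self_eq_norm_sq_to_K]
    simp [← Complex.ofReal_pow]
  unfold trace
  simp_rw [key]
  rw [tsum_norm_sq_eq _ b, hSa]

theorem rpow_apply_eq_zero {A : H →L[ℂ] H} {s t : ℝ} (hs : 0 < s) (ht : 0 < t) {x : H}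
    (hx : (A ^ s) x = 0) : (A ^ t) x = 0 := by
  have add : ∀ p q : ℝ, 0 < p → 0 < q → A ^ (p + q) = A ^ p * A ^ q := by
    intro p q hp hq
    lift p to ℝ≥0 using hp.le
    lift q to ℝ≥0 using hq.le
    have hp' : 0 < p := by exact_mod_cast hp
    have hq' : 0 < q := by exact_mod_cast hq
    rw [← NNReal.coe_add, ← CFC.nnrpow_eq_rpow (add_pos hp' hq'), ← CFC.nnrpow_eq_rpow hp',
      ← CFC.nnrpow_eq_rpow hq', CFC.nnrpow_add hp' hq']
  have half : ∀ n : ℕ, (A ^ (s / 2 ^ n)) x = 0 := by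
    intro n
    induction n with
    | zero => simpa using hx
    | succ n ih =>
      have hp : 0 < s / 2 ^ (n + 1) := by positivity
      have e : s / 2 ^ n = s / 2 ^ (n + 1) + s / 2 ^ (n + 1) := by
        rw [pow_succ]; field_simp; norm_num
      rw [e, add _ _ hp hp] at ih
      set B := A ^ (s / 2 ^ (n + 1))
      have hB : ContinuousLinearMap.adjoint B = B :=
        (IsSelfAdjoint.of_nonneg (CFC.rpow_nonneg)).star_eq
      have h0 : inner ℂ (B x) (B x) = 0 := by
        rw [← ContinuousLinearMap.adjoint_inner_right, hB]
        rw [mul_apply_eq_comp] at ih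
        rw [ih, inner_zero_right]
      exact inner_self_eq_zero.mp h0
  obtain ⟨n, hn⟩ := exists_pow_lt_of_lt_one (div_pos ht hs) (by norm_num : (1 / 2 : ℝ) < 1)
  have hlt : s / 2 ^ n < t := by
    rw [lt_div_iff₀ hs] at hn
    rw [one_div, inv_pow] at hn
    rw [div_eq_inv_mul]
    exact hn
  have e : t = (t - s / 2 ^ n) + s / 2 ^ n := by ring
  rw [e, add _ _ (by linarith) (by positivity), mul_apply_eq_comp, half n, map_zero]

theorem ker_rpow {A : H →L[ℂ] H} (hA : 0 ≤ A) {s : ℝ} (hs : 0 < s) : (A ^ s).ker = A.ker := by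
  ext x
  have h1 : A ^ (1 : ℝ) = A := CFC.rpow_one A hA
  constructor
  · intro hx
    have := rpow_apply_eq_zero hs one_pos (A := A) (x := x) hx
    rwa [h1] at this
  · intro hx
    exact rpow_apply_eq_zero one_pos hs (A := A) (x := x) (by rw [h1]; exact hx)

theorem supp_le_supp_iff {A B : H →L[ℂ] H} : supp A ≤ supp B ↔ B.ker ≤ A.ker := by
  unfold supp
  rw [Submodule.starProjection_le_starProjection_iff]
  have hA : IsClosed (A.ker : Set H) := A.isClosed_ker
  have hB : IsClosed (B.ker : Set H) := B.isClosed_ker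
  constructor
  · intro h
    have h2 := Submodule.orthogonal_le h
    have : CompleteSpace A.ker := hA.completeSpace_coe
    have : CompleteSpace B.ker := hB.completeSpace_coe
    rwa [Submodule.orthogonal_orthogonal, Submodule.orthogonal_orthogonal] at h2
  · intro h
    exact Submodule.orthogonal_le h

theorem isSelfAdjoint_supp (A : H →L[ℂ] H) : ContinuousLinearMap.adjoint (supp A) = supp A :=
  (isSelfAdjoint_starProjection _).star_eq

theorem apply_supp {A B : H →L[ℂ] H} (h : B.ker = A.ker) (x : H) : B (supp A x) = B x := by
  have h1 : x - supp A x ∈ ((A.ker)ᗮ)ᗮ := Submodule.sub_starProjection_mem_orthogonal x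
  have : CompleteSpace A.ker := A.isClosed_ker.completeSpace_coe
  rw [Submodule.orthogonal_orthogonal, ← h] at h1
  have h2 : B (x - supp A x) = 0 := h1
  rw [map_sub, sub_eq_zero] at h2
  exact h2.symm

theorem supp_mem_closure {A B : H →L[ℂ] H} (h : B.ker = A.ker) (hB : 0 ≤ B) (x : H) :
    supp A x ∈ closure (Set.range B) := by
  have hBa : ContinuousLinearMap.adjoint B = B := (IsSelfAdjoint.of_nonneg hB).star_eq
  have h1 : supp A x ∈ (A.ker)ᗮ := Submodule.starProjection_apply_mem _ x
  rw [← h, ContinuousLinearMap.orthogonal_ker, hBa] at h1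
  rw [← SetLike.mem_coe, Submodule.topologicalClosure_coe] at h1
  exact h1

open scoped ComplexOrder in
/-- For `ρ ∈ B^{α,z}(H, σ)` there is exactly one PSD operator as required in the definition
of `ρ_{σ,α,z}`. -/
theorem existsUnique_sandwich {α z : ℝ} (hα : 1 < α) (hz : 0 < z) {ρ σ : H →L[ℂ] H}
    (hσ : σ ∈ nonzeroPSD H) (hρ : ρ ∈ boundedSet α z σ) :
    ∃! R : H →L[ℂ] H, 0 ≤ R ∧ supp R ≤ supp σ ∧ Factorizes α z ρ σ R := by
  obtain ⟨-, R, hR⟩ := hρ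
  have hp : 0 < (α - 1) / (2 * z) := div_pos (by linarith) (by linarith)
  unfold Factorizes at hR ⊢
  set B := σ ^ ((α - 1) / (2 * z)) with hBdef
  have hB0 : 0 ≤ B := CFC.rpow_nonneg
  have hBa : ContinuousLinearMap.adjoint B = B := (IsSelfAdjoint.of_nonneg hB0).star_eq
  have hker : B.ker = σ.ker := ker_rpow hσ.1 hp
  have hP : 0 ≤ ρ ^ (α / z) := CFC.rpow_nonneg
  set S := supp σ with hS
  have hSa : ContinuousLinearMap.adjoint S = S := isSelfAdjoint_supp σ
  have hBS : B * S = B := by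
    ext x; exact apply_supp hker x
  have hSB : S * B = B := by
    have := congrArg star hBS
    rw [star_mul] at this
    rwa [ContinuousLinearMap.star_eq_adjoint, ContinuousLinearMap.star_eq_adjoint, hSa, hBa]
      at this
  have hcl : ∀ x, S x ∈ closure (Set.range B) := supp_mem_closure hker hB0
  refine ⟨S * R * S, ⟨?_, ?_, ?_⟩, ?_⟩
  · rw [ContinuousLinearMap.nonneg_iff_isPositive,
      ContinuousLinearMap.isPositive_iff_complex]
    have hpos : ∀ y ∈ closure (Set.range B), 0 ≤ inner ℂ (R y) y := by
      intro y hy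
      have hclosed : IsClosed {y : H | 0 ≤ inner ℂ (R y) y} :=
        isClosed_le continuous_const (by fun_prop)
      refine closure_minimal ?_ hclosed hy
      rintro _ ⟨x, rfl⟩
      have h1 := ((ContinuousLinearMap.nonneg_iff_isPositive _).mp hP).inner_nonneg_left x
      rw [hR] at h1
      simpa [mul_apply_eq_comp, ← ContinuousLinearMap.adjoint_inner_right, hBa]
        using h1
    intro x
    have h2 := hpos (S x) (hcl x)
    have h3 : inner ℂ ((S * R * S) x) x = inner ℂ (R (S x)) (S x) := by
      rw [← ContinuousLinearMap.adjoint_inner_left, hSa]; rfl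
    rw [h3]
    obtain ⟨h4, h5⟩ := Complex.nonneg_iff.mp h2
    exact ⟨Complex.ext rfl h5, h4⟩
  · rw [supp_le_supp_iff]
    intro x hx
    have h1 : B x = 0 := by rw [← hker] at hx; exact hx
    have h2 : S x = 0 := by
      have h3 : x ∈ ((σ.ker)ᗮ)ᗮ := Submodule.le_orthogonal_orthogonal _ hx
      rw [hS]; exact (Submodule.starProjection_apply_eq_zero_iff _).mpr h3
    change S (R (S x)) = 0
    rw [h2, map_zero, map_zero]
  · calc ρ ^ (α / z) = B * R * B := hR
      _ = (B * S) * R * (S * B) := by rw [hBS, hSB]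
      _ = B * (S * R * S) * B := by noncomm_ring
  · rintro T ⟨hT0, hTs, hT⟩
    rw [supp_le_supp_iff] at hTs
    have hTS : T * S = T := by
      ext x
      have h1 : x - S x ∈ ((σ.ker)ᗮ)ᗮ := Submodule.sub_starProjection_mem_orthogonal x
      have : CompleteSpace σ.ker := σ.isClosed_ker.completeSpace_coe
      rw [Submodule.orthogonal_orthogonal] at h1
      have h2 : T (x - S x) = 0 := hTs h1
      rw [map_sub, sub_eq_zero] at h2
      exact h2.symm
    have hST : S * T = T := by
      have := congrArg star hTS
      rw [star_mul] at this
      rwa [ContinuousLinearMap.star_eq_adjoint, ContinuousLinearMap.star_eq_adjoint, hSa,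
        (IsSelfAdjoint.of_nonneg hT0).adjoint_eq] at this
    have hEq : B * (T - R) * B = 0 := by
      rw [mul_sub, sub_mul, ← hT, ← hR, sub_self]
    have hin : ∀ x y : H, inner ℂ (S x) ((T - R) (S y)) = 0 := by
      intro x y
      have hc : IsClosed {p : H × H | inner ℂ p.1 ((T - R) p.2) = 0} :=
        isClosed_eq (by fun_prop) continuous_const
      have hmem : (S x, S y) ∈ closure (Set.range B ×ˢ Set.range B) := by
        rw [closure_prod_eq]; exact ⟨hcl x, hcl y⟩
      refine closure_minimal ?_ hc hmem
      rintro ⟨_, _⟩ ⟨⟨u, rfl⟩, ⟨v, rfl⟩⟩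
      change inner ℂ (B u) ((T - R) (B v)) = 0
      rw [← ContinuousLinearMap.adjoint_inner_right, hBa]
      have := congrArg (fun F : H →L[ℂ] H => F v) hEq
      have h' : B ((T - R) (B v)) = 0 := this
      rw [h', inner_zero_right]
    have hz0 : S * (T - R) * S = 0 := by
      ext y
      refine ext_inner_left ℂ fun x => ?_
      change inner ℂ x (S ((T - R) (S y))) = _
      rw [← ContinuousLinearMap.adjoint_inner_left, hSa, hin]
      simp
    rw [mul_sub, sub_mul, hST, hTS, sub_eq_zero] at hz0
    exact hz0

/-- The defining properties of `ρ_{σ,α,z}`. -/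
theorem sandwich_spec {α z : ℝ} (hα : 1 < α) (hz : 0 < z) {ρ σ : H →L[ℂ] H}
    (hσ : σ ∈ nonzeroPSD H) (hρ : ρ ∈ boundedSet α z σ) :
    0 ≤ sandwich α z ρ σ ∧ supp (sandwich α z ρ σ) ≤ supp σ ∧
      Factorizes α z ρ σ (sandwich α z ρ σ) := by
  have h := (existsUnique_sandwich hα hz hσ hρ).exists
  unfold sandwich
  rw [dif_pos h]
  exact h.choose_spec

end WellDefined

end RenyiAZ

/-! Fix z ≤ z' and put r = z'/z ≥ 1, a = ρ^(α/z'), b = σ^((α-1)/z'). If R and T are the operators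
ρ_{σ,α,z} and ρ_{σ,α,z'}, then a^r = b^(r/2) R b^(r/2) and a = b^(1/2) T b^(1/2). All claims reduce
to two facts: T exists as soon as R does, and Tr T^(rz) ≤ Tr R^z, an Araki–Lieb–Thirring inequality
with negative powers of b.

Existence (`exists_eq_conj_of_rpow`): a^r ≤ ‖R‖ b^r, so operator monotonicity of t ↦ t^(1/r) gives a
≤ ‖R‖^(1/r) b, and Douglas' factorization produces the middle operator.

The trace inequality goes through logarithmic majorization. Let N_k(X) be the norm of the k-th
antisymmetric power of X (`compoundNorm`). It is submultiplicative, satisfies N_k(X)² ≤ N_k(X* X),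
and a spectral radius argument allows factors of a self-adjoint product to be swapped
(`compoundNorm_mul_le_swap`). Hence s ↦ N_k(a^s b^(-s)) is midpoint log-convex, and formally N_k(T)
= N_k(a^(1/2) b^(-1/2))² ≤ N_k(a^(r/2) b^(-r/2))^(2/r) = N_k(R)^(1/r). Since b need not be
invertible, b^(-s) is truncated and the truncation is removed by weak lower semicontinuity of N_k
(`compoundNorm_sandwich_le`). Taking powers, N_k(T^(rz)) ≤ N_k(R^z) for every k.

No compactness is available, so singular values are replaced by ordered eigenvalues of compressions
to finite-dimensional subspaces. Their partial products are bounded by N_k and come arbitrarily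
close to it; weak log-majorization gives weak majorization, and then the comparison of traces
(`trace_le_of_compoundNorm_le`). -/

namespace RenyiAZ

/-! ### Norms of antisymmetric tensor powers, expressed through determinants. -/

section CompoundNorm

variable {H : Type*} [NormedAddCommGroup H] [InnerProductSpace ℂ H]

/-- The matrix of the sesquilinear form of `X` along two families of vectors. -/
noncomputable def formMatrix {k : ℕ} (u : Fin k → H) (X : H →L[ℂ] H) (v : Fin k → H) :
    Matrix (Fin k) (Fin k) ℂ :=
  Matrix.of fun i j => inner ℂ (u i) (X (v j))

theorem exists_orthonormal_of_linearIndependent {k : ℕ} {y : Fin k → H}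
    (hy : LinearIndependent ℂ y) :
    ∃ w : Fin k → H, Orthonormal ℂ w ∧ ∀ j, y j = ∑ l, inner ℂ (w l) (y j) • w l := by
  have hw := InnerProductSpace.gramSchmidtNormed_orthonormal (𝕜 := ℂ) hy
  refine ⟨_, hw, fun j => ?_⟩
  have hmem : y j ∈ Submodule.span ℂ (Set.range (InnerProductSpace.gramSchmidtNormed ℂ y)) := by
    rw [InnerProductSpace.span_gramSchmidtNormed_range, InnerProductSpace.span_gramSchmidt]
    exact Submodule.subset_span ⟨j, rfl⟩
  obtain ⟨c, hc⟩ := (Submodule.mem_span_range_iff_exists_fun ℂ).1 hmem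
  have hcl : ∀ l, inner ℂ (InnerProductSpace.gramSchmidtNormed ℂ y l) (y j) = c l := by
    intro l
    rw [← hc, hw.inner_right_fintype]
  simp_rw [hcl, hc]

/-- The hypothesis says that each `X (v j)` lies in the span of `w`, so inserting the projection
onto that span between `Y` and `X` changes nothing. -/
theorem formMatrix_mul {k : ℕ} {u v w : Fin k → H} {X Y : H →L[ℂ] H}
    (hw : ∀ j, X (v j) = ∑ l, inner ℂ (w l) (X (v j)) • w l) :
    formMatrix u (Y * X) v = formMatrix u Y w * formMatrix w X v := by
  ext i j
  rw [Matrix.mul_apply]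
  change inner ℂ (u i) (Y (X (v j))) = _
  rw [hw j, map_sum, inner_sum]
  refine Finset.sum_congr rfl fun l _ => ?_
  rw [map_smul, inner_smul_right, mul_comm]
  rfl

theorem det_formMatrix_eq_zero {k : ℕ} {u v : Fin k → H} {X : H →L[ℂ] H} (Y : H →L[ℂ] H)
    (h : ¬ LinearIndependent ℂ fun j => X (v j)) : (formMatrix u (Y * X) v).det = 0 := by
  rw [Fintype.not_linearIndependent_iff] at h
  obtain ⟨g, hg, i, hi⟩ := h
  refine Matrix.exists_mulVec_eq_zero_iff.1 ⟨g, fun h0 => hi (by rw [h0]; rfl), ?_⟩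
  ext a
  change ∑ j, inner ℂ (u a) (Y (X (v j))) * g j = 0
  have : inner ℂ (u a) (Y (∑ j, g j • X (v j))) = 0 := by rw [hg, map_zero, inner_zero_right]
  rw [map_sum, inner_sum] at this
  rw [← this]
  refine Finset.sum_congr rfl fun j _ => ?_
  rw [map_smul, inner_smul_right, mul_comm]

-- The arithmetic-geometric mean inequality for the eigenvalues, obtained from t ≤ exp (t - 1) at t
-- = λ/c.
open scoped ComplexOrder in
theorem det_re_le_pow_of_trace_le {k : ℕ} {M : Matrix (Fin k) (Fin k) ℂ} (hM : M.PosSemidef)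
    {c : ℝ} (hc : 0 < c) (htr : M.trace.re ≤ k * c) : M.det.re ≤ c ^ k := by
  have hdet : M.det.re = ∏ i, hM.isHermitian.eigenvalues i := by
    rw [hM.isHermitian.det_eq_prod_eigenvalues]
    simp [← Complex.ofReal_prod]
  have htr' : M.trace.re = ∑ i, hM.isHermitian.eigenvalues i := by
    rw [hM.isHermitian.trace_eq_sum_eigenvalues]
    simp
  rw [hdet]
  rw [htr'] at htr
  calc ∏ i, hM.isHermitian.eigenvalues i
      ≤ ∏ i, c * Real.exp (hM.isHermitian.eigenvalues i / c - 1) := by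
        refine Finset.prod_le_prod (fun i _ => hM.eigenvalues_nonneg i) fun i _ => ?_
        have h1 := Real.add_one_le_exp (hM.isHermitian.eigenvalues i / c - 1)
        rw [sub_add_cancel, div_le_iff₀' hc] at h1
        exact h1
    _ = c ^ k * Real.exp (∑ i, (hM.isHermitian.eigenvalues i / c - 1)) := by
        rw [Finset.prod_mul_distrib, Real.exp_sum]
        simp
    _ ≤ c ^ k * 1 := by
        refine mul_le_mul_of_nonneg_left ?_ (by positivity)
        rw [Real.exp_le_one_iff, Finset.sum_sub_distrib, ← Finset.sum_div]
        simp only [Finset.sum_const, Finset.card_univ, Fintype.card_fin, nsmul_eq_mul, mul_one]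
        rw [sub_nonpos, div_le_iff₀ hc]
        exact htr
    _ = c ^ k := mul_one _

-- By Bessel each column of the matrix has squared length at most ‖X‖², which bounds the trace of
-- its Gram matrix. This serves both to make the supremum in `compoundNorm` finite and, with c = 1,
-- to treat contractions.
open scoped ComplexOrder in
theorem norm_det_formMatrix_sq_le {k : ℕ} {u v : Fin k → H} (hu : Orthonormal ℂ u)
    (hv : Orthonormal ℂ v) (X : H →L[ℂ] H) {c : ℝ} (hc : 0 < c) (hX : ‖X‖ ^ 2 ≤ c) :
    ‖(formMatrix u X v).det‖ ^ 2 ≤ c ^ k := by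
  set G := formMatrix u X v with hG
  have h1 : (G.conjTranspose * G).det.re = ‖G.det‖ ^ 2 := by
    rw [Matrix.det_mul, Matrix.det_conjTranspose]
    have := Complex.conj_mul' G.det
    rw [← Complex.ofReal_pow] at this
    exact (congrArg Complex.re this).trans (Complex.ofReal_re _)
  rw [← h1]
  refine det_re_le_pow_of_trace_le (Matrix.posSemidef_conjTranspose_mul_self G) hc ?_
  have h2 : (G.conjTranspose * G).trace.re = ∑ j, ∑ i, ‖G i j‖ ^ 2 := by
    simp only [Matrix.trace, Matrix.diag_apply, Matrix.mul_apply, Matrix.conjTranspose_apply,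
      Complex.re_sum]
    refine Finset.sum_congr rfl fun j _ => Finset.sum_congr rfl fun i _ => ?_
    have := Complex.conj_mul' (G i j)
    rw [← Complex.ofReal_pow] at this
    exact (congrArg Complex.re this).trans (Complex.ofReal_re _)
  rw [h2]
  calc ∑ j, ∑ i, ‖G i j‖ ^ 2 ≤ ∑ _j : Fin k, c := by
        refine Finset.sum_le_sum fun j _ => ?_
        calc ∑ i, ‖G i j‖ ^ 2 ≤ ‖X (v j)‖ ^ 2 := hu.sum_inner_products_le (X (v j))
          _ ≤ ‖X‖ ^ 2 := by
            have := X.le_opNorm (v j)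
            rw [hv.1 j, mul_one] at this
            gcongr
          _ ≤ c := hX
    _ = k * c := by simp

/-- The norm of the `k`-th antisymmetric tensor power of `X`, as a supremum of determinants. -/
noncomputable def compoundNorm (k : ℕ) (X : H →L[ℂ] H) : ℝ :=
  ⨆ p : {u : Fin k → H // Orthonormal ℂ u} × {v : Fin k → H // Orthonormal ℂ v},
    ‖(formMatrix p.1.1 X p.2.1).det‖

theorem norm_det_le_compoundNorm {k : ℕ} {u v : Fin k → H} (hu : Orthonormal ℂ u)
    (hv : Orthonormal ℂ v) (X : H →L[ℂ] H) :
    ‖(formMatrix u X v).det‖ ≤ compoundNorm k X := by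
  refine le_ciSup (f := fun p : {u : Fin k → H // Orthonormal ℂ u} ×
    {v : Fin k → H // Orthonormal ℂ v} => ‖(formMatrix p.1.1 X p.2.1).det‖) ?_
    ⟨⟨u, hu⟩, ⟨v, hv⟩⟩
  -- The summand 1 keeps the constant positive when `X = 0`.
  refine ⟨√((‖X‖ ^ 2 + 1) ^ k), ?_⟩
  rintro _ ⟨p, rfl⟩
  exact Real.le_sqrt_of_sq_le
    (norm_det_formMatrix_sq_le p.1.2 p.2.2 X (by positivity) (by linarith))

theorem compoundNorm_nonneg (k : ℕ) (X : H →L[ℂ] H) : 0 ≤ compoundNorm k X :=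
  Real.iSup_nonneg fun _ => norm_nonneg _

/-- Nonnegativity of `c` covers dim H < k, where there are no orthonormal families and the real
supremum over the empty type is 0. -/
theorem compoundNorm_le {k : ℕ} {X : H →L[ℂ] H} {c : ℝ} (hc : 0 ≤ c)
    (h : ∀ u v : Fin k → H, Orthonormal ℂ u → Orthonormal ℂ v →
      ‖(formMatrix u X v).det‖ ≤ c) : compoundNorm k X ≤ c :=
  Real.iSup_le (fun p => h _ _ p.1.2 p.2.2) hc

theorem compoundNorm_le_one (k : ℕ) {X : H →L[ℂ] H} (hX : ‖X‖ ≤ 1) : compoundNorm k X ≤ 1 := by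
  refine compoundNorm_le zero_le_one fun u v hu hv => ?_
  have := norm_det_formMatrix_sq_le hu hv X one_pos (pow_le_one₀ (norm_nonneg _) hX)
  rw [one_pow] at this
  exact (sq_le_one_iff₀ (norm_nonneg _)).1 this

/-- Gram–Schmidt applied to the vectors `X (v j)` gives an intermediate orthonormal family through
which the determinant factors; if these vectors are dependent, the determinant vanishes. -/
theorem compoundNorm_mul_le (k : ℕ) (Y X : H →L[ℂ] H) :
    compoundNorm k (Y * X) ≤ compoundNorm k Y * compoundNorm k X := by
  have h0 := mul_nonneg (compoundNorm_nonneg k Y) (compoundNorm_nonneg k X)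
  refine compoundNorm_le h0 fun u v hu hv => ?_
  by_cases h : LinearIndependent ℂ fun j => X (v j)
  · obtain ⟨w, hw, hwX⟩ := exists_orthonormal_of_linearIndependent h
    rw [formMatrix_mul hwX, Matrix.det_mul, norm_mul]
    exact mul_le_mul (norm_det_le_compoundNorm hu hw Y) (norm_det_le_compoundNorm hw hv X)
      (norm_nonneg _) (compoundNorm_nonneg k Y)
  · rw [det_formMatrix_eq_zero Y h, norm_zero]
    exact h0

/-- Lower semicontinuity of the compound norm in the weak operator topology. -/
theorem compoundNorm_le_of_tendsto {k : ℕ} {ι : Type*} {l : Filter ι} [l.NeBot]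
    {X : ι → H →L[ℂ] H} {Y : H →L[ℂ] H} {c : ι → ℝ} {d : ℝ}
    (hX : ∀ x y : H, Filter.Tendsto (fun i => inner ℂ x (X i y)) l (nhds (inner ℂ x (Y y))))
    (hc : Filter.Tendsto c l (nhds d)) (h : ∀ᶠ i in l, compoundNorm k (X i) ≤ c i) :
    compoundNorm k Y ≤ d := by
  have hd : 0 ≤ d := ge_of_tendsto hc (h.mono fun i hi => (compoundNorm_nonneg k _).trans hi)
  refine compoundNorm_le hd fun u v hu hv => ?_
  have h1 : Filter.Tendsto (fun i => formMatrix u (X i) v) l (nhds (formMatrix u Y v)) :=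
    tendsto_pi_nhds.2 fun _ => tendsto_pi_nhds.2 fun _ => hX _ _
  have h2 : Filter.Tendsto (fun i => ‖(formMatrix u (X i) v).det‖) l
      (nhds ‖(formMatrix u Y v).det‖) :=
    ((Continuous.matrix_det continuous_id).norm.tendsto _).comp h1
  exact le_of_tendsto_of_tendsto h2 hc
    (h.mono fun i hi => (norm_det_le_compoundNorm hu hv _).trans hi)

variable [CompleteSpace H]

theorem formMatrix_star {k : ℕ} (u v : Fin k → H) (X : H →L[ℂ] H) :
    formMatrix u (star X) v = (formMatrix v X u).conjTranspose := by
  ext i j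
  change inner ℂ (u i) (star X (v j)) = star (inner ℂ (v j) (X (u i)))
  rw [ContinuousLinearMap.star_eq_adjoint, ContinuousLinearMap.adjoint_inner_right]
  exact (inner_conj_symm _ _).symm

theorem compoundNorm_star (k : ℕ) (X : H →L[ℂ] H) :
    compoundNorm k (star X) = compoundNorm k X := by
  have h : ∀ Y : H →L[ℂ] H, compoundNorm k (star Y) ≤ compoundNorm k Y := by
    intro Y
    refine compoundNorm_le (compoundNorm_nonneg k Y) fun u v hu hv => ?_
    rw [formMatrix_star, Matrix.det_conjTranspose, norm_star]
    exact norm_det_le_compoundNorm hv hu Y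
  refine le_antisymm (h X) ?_
  conv_lhs => rw [← star_star X]
  exact h _

/-- With `w` the orthonormalization of the `X (v j)`, the right side is exactly |det ⟨w, X v⟩|²,
while the determinant on the left has the additional factor det ⟨u, w⟩, of modulus at most 1. -/
theorem norm_det_formMatrix_sq_le_norm_det {k : ℕ} {u v : Fin k → H} (hu : Orthonormal ℂ u)
    (X : H →L[ℂ] H) :
    ‖(formMatrix u X v).det‖ ^ 2 ≤ ‖(formMatrix v (star X * X) v).det‖ := by
  by_cases h : LinearIndependent ℂ fun j => X (v j)
  · obtain ⟨w, hw, hwX⟩ := exists_orthonormal_of_linearIndependent h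
    have h1 : formMatrix u X v = formMatrix u 1 w * formMatrix w X v := by
      rw [← formMatrix_mul hwX, one_mul]
    have h2 : ‖(formMatrix u 1 w).det‖ ≤ 1 :=
      (norm_det_le_compoundNorm hu hw 1).trans
        (compoundNorm_le_one k ContinuousLinearMap.norm_id_le)
    rw [formMatrix_mul hwX, formMatrix_star, h1, Matrix.det_mul, Matrix.det_mul,
      Matrix.det_conjTranspose, norm_mul, norm_mul, norm_star, mul_pow, ← sq]
    exact mul_le_of_le_one_left (by positivity) (pow_le_one₀ (norm_nonneg _) h2)
  · have := det_formMatrix_eq_zero (u := u) 1 h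
    rw [one_mul] at this
    rw [this, norm_zero, zero_pow two_ne_zero]
    exact norm_nonneg _

theorem compoundNorm_sq_le (k : ℕ) (X : H →L[ℂ] H) :
    compoundNorm k X ^ 2 ≤ compoundNorm k (star X * X) := by
  have h0 := compoundNorm_nonneg k (star X * X)
  have : compoundNorm k X ≤ √(compoundNorm k (star X * X)) :=
    compoundNorm_le (Real.sqrt_nonneg _) fun u v hu hv =>
      Real.le_sqrt_of_sq_le ((norm_det_formMatrix_sq_le_norm_det hu X).trans
        (norm_det_le_compoundNorm hv hv _))
  calc _ ≤ √(compoundNorm k (star X * X)) ^ 2 := by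
        have := compoundNorm_nonneg k X
        gcongr
    _ = _ := Real.sq_sqrt h0

/-- For `0 ≤ B` the supremum may be taken over pairs of equal families. -/
theorem compoundNorm_le_of_nonneg {k : ℕ} {B : H →L[ℂ] H} (hB : 0 ≤ B) {c : ℝ} (hc : 0 ≤ c)
    (h : ∀ v : Fin k → H, Orthonormal ℂ v → ‖(formMatrix v B v).det‖ ≤ c) :
    compoundNorm k B ≤ c := by
  set S := CFC.sqrt B
  have hS : star S * S = B := by
    rw [(IsSelfAdjoint.of_nonneg (CFC.sqrt_nonneg B)).star_eq, CFC.sqrt_mul_sqrt_self B hB]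
  have h1 : compoundNorm k S ≤ √c :=
    compoundNorm_le (Real.sqrt_nonneg _) fun u v hu hv =>
      Real.le_sqrt_of_sq_le ((norm_det_formMatrix_sq_le_norm_det hu S).trans
        (hS ▸ h v hv))
  calc compoundNorm k B = compoundNorm k (star S * S) := by rw [hS]
    _ ≤ compoundNorm k (star S) * compoundNorm k S := compoundNorm_mul_le k _ _
    _ = compoundNorm k S * compoundNorm k S := by rw [compoundNorm_star]
    _ ≤ √c * √c := mul_self_le_mul_self (compoundNorm_nonneg k S) h1
    _ = c := Real.mul_self_sqrt hc

end CompoundNorm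

/-! ### Spectral radius estimates and log-convexity. -/

section PowerInequalities

/-- The power trick: if y < x, dividing by x^(2^n - 1) bounds x by C (y/x)^(2^n - 1), which tends to
0. The constant `C` is thus immaterial. -/
theorem le_of_two_pow_le {x y C : ℝ} (hx : 0 ≤ x) (hy : 0 ≤ y)
    (h : ∀ n : ℕ, x ^ (2 ^ n) ≤ C * y ^ (2 ^ n - 1)) : x ≤ y := by
  by_contra! hlt
  have hx0 : 0 < x := hy.trans_lt hlt
  have hb : ∀ n : ℕ, x ≤ C * (y / x) ^ (2 ^ n - 1) := by
    intro n
    have h1 : x ^ (2 ^ n) = x ^ (2 ^ n - 1) * x := by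
      rw [← pow_succ, Nat.sub_add_cancel Nat.one_le_two_pow]
    have h2 := h n
    rw [h1] at h2
    rw [div_pow, mul_div_assoc', le_div_iff₀ (by positivity), mul_comm]
    exact h2
  have hexp : Filter.Tendsto (fun n : ℕ => 2 ^ n - 1) Filter.atTop Filter.atTop :=
    (Filter.tendsto_sub_atTop_nat 1).comp (tendsto_pow_atTop_atTop_of_one_lt one_lt_two)
  have hlim : Filter.Tendsto (fun n : ℕ => C * (y / x) ^ (2 ^ n - 1)) Filter.atTop
      (nhds (C * 0)) :=
    ((tendsto_pow_atTop_nhds_zero_of_lt_one (div_nonneg hy hx)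
      ((div_lt_one hx0).2 hlt)).comp hexp).const_mul C
  have := ge_of_tendsto' hlim hb
  linarith

/-- A midpoint log-convex function on `[0, 1]` lies below its logarithmic chord at dyadic points. -/
theorem le_rpow_of_midpoint {f : ℝ → ℝ} (hf : ∀ s, 0 ≤ f s) (h0 : f 0 ≤ 1)
    (hmid : ∀ s t, 0 ≤ s → s ≤ t → f ((s + t) / 2) ^ 2 ≤ f s * f t) (n m : ℕ) (hm : m ≤ 2 ^ n) :
    f (m / 2 ^ n) ≤ f 1 ^ ((m : ℝ) / 2 ^ n) := by
  induction n generalizing m with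
  | zero =>
    obtain rfl | rfl : m = 0 ∨ m = 1 := by rw [pow_zero] at hm; omega
    · simpa using h0
    · simp
  | succ n ih =>
    obtain ⟨l, rfl | rfl⟩ := Nat.even_or_odd' m
    · have e : ((2 * l : ℕ) : ℝ) / 2 ^ (n + 1) = l / 2 ^ n := by
        push_cast; rw [pow_succ]; field_simp
      rw [e]
      exact ih l (by rw [pow_succ] at hm; omega)
    -- An odd numerator 2l + 1 is the midpoint of two neighbouring points of the coarser dyadic
    -- grid.
    · have h1 := ih l (by rw [pow_succ] at hm; omega)
      have h2 := ih (l + 1) (by rw [pow_succ] at hm; omega)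
      have e : ((2 * l + 1 : ℕ) : ℝ) / 2 ^ (n + 1) =
          ((l : ℝ) / 2 ^ n + ((l + 1 : ℕ) : ℝ) / 2 ^ n) / 2 := by
        push_cast; rw [pow_succ]; field_simp; ring
      rw [e]
      have hF := hf 1
      refine le_of_sq_le_sq ?_ (Real.rpow_nonneg hF _)
      calc _ ≤ f (l / 2 ^ n) * f ((l + 1 : ℕ) / 2 ^ n) :=
            hmid _ _ (by positivity) (by gcongr; simp)
        _ ≤ f 1 ^ ((l : ℝ) / 2 ^ n) * f 1 ^ (((l + 1 : ℕ) : ℝ) / 2 ^ n) :=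
            mul_le_mul h1 h2 (hf _) (Real.rpow_nonneg hF _)
        _ = _ := by
            rw [← Real.rpow_add_of_nonneg hF (by positivity) (by positivity),
              ← Real.rpow_mul_natCast hF]
            congr 1
            push_cast
            ring

variable {H : Type*} [NormedAddCommGroup H] [InnerProductSpace ℂ H]

theorem compoundNorm_pow_le (k : ℕ) (X : H →L[ℂ] H) (m : ℕ) :
    compoundNorm k (X ^ m) ≤ compoundNorm k X ^ m := by
  induction m with
  | zero =>
    rw [pow_zero, pow_zero]
    exact compoundNorm_le_one k ContinuousLinearMap.norm_id_le
  | succ m ih =>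
    rw [pow_succ, pow_succ]
    exact (compoundNorm_mul_le k _ _).trans
      (mul_le_mul_of_nonneg_right ih (compoundNorm_nonneg k X))

variable [CompleteSpace H]

theorem compoundNorm_two_pow_le (k : ℕ) {X : H →L[ℂ] H} (hX : IsSelfAdjoint X) (n : ℕ) :
    compoundNorm k X ^ (2 ^ n) ≤ compoundNorm k (X ^ (2 ^ n)) := by
  induction n with
  | zero => simp
  | succ n ih =>
    rw [pow_succ, pow_mul, pow_mul]
    calc (compoundNorm k X ^ 2 ^ n) ^ 2 ≤ compoundNorm k (X ^ 2 ^ n) ^ 2 := by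
          have := compoundNorm_nonneg k X
          gcongr
      _ ≤ compoundNorm k (star (X ^ 2 ^ n) * X ^ 2 ^ n) := compoundNorm_sq_le k _
      _ = _ := by rw [(hX.pow _).star_eq, ← sq]

/-- The spectral radius estimate: a self-adjoint product is dominated by the reversed product. -/
theorem compoundNorm_mul_le_swap (k : ℕ) {X Y : H →L[ℂ] H} (h : IsSelfAdjoint (X * Y)) :
    compoundNorm k (X * Y) ≤ compoundNorm k (Y * X) := by
  have hpow : ∀ m : ℕ, (X * Y) ^ (m + 1) = X * (Y * X) ^ m * Y := by
    intro m
    induction m with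
    | zero => simp
    | succ m ih => rw [pow_succ, ih, pow_succ]; noncomm_ring
  refine le_of_two_pow_le (C := compoundNorm k X * compoundNorm k Y) (compoundNorm_nonneg _ _)
    (compoundNorm_nonneg _ _) fun n => ?_
  obtain ⟨m, hm⟩ : ∃ m, 2 ^ n = m + 1 := ⟨2 ^ n - 1, (Nat.sub_add_cancel Nat.one_le_two_pow).symm⟩
  have h1 := compoundNorm_two_pow_le k h n
  rw [hm, hpow] at h1
  rw [hm, Nat.add_sub_cancel]
  refine h1.trans ?_
  have hX := compoundNorm_nonneg k X
  have hY := compoundNorm_nonneg k Y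
  calc _ ≤ compoundNorm k (X * (Y * X) ^ m) * compoundNorm k Y := compoundNorm_mul_le k _ _
    _ ≤ compoundNorm k X * compoundNorm k ((Y * X) ^ m) * compoundNorm k Y := by
        gcongr; exact compoundNorm_mul_le k _ _
    _ ≤ compoundNorm k X * compoundNorm k (Y * X) ^ m * compoundNorm k Y := by
        gcongr; exact compoundNorm_pow_le k _ _
    _ = _ := by ring

/-- A Heinz inequality for the compound norms, for two self-adjoint semigroups. -/
theorem compoundNorm_semigroup_mul_le (k : ℕ) {a c : ℝ → H →L[ℂ] H}
    (ha : ∀ s, IsSelfAdjoint (a s)) (hc : ∀ s, IsSelfAdjoint (c s))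
    (ha0 : ‖a 0‖ ≤ 1) (hc0 : ‖c 0‖ ≤ 1)
    (haa : ∀ s t, 0 ≤ s → 0 ≤ t → a (s + t) = a s * a t)
    (hcc : ∀ s t, 0 ≤ s → 0 ≤ t → c (s + t) = c s * c t)
    (hac : ∀ s, 0 < s → ContinuousAt a s) (hcc' : ∀ s, 0 < s → ContinuousAt c s)
    {s : ℝ} (hs0 : 0 ≤ s) (hs1 : s ≤ 1) :
    compoundNorm k (a s * c s) ≤ compoundNorm k (a 1 * c 1) ^ s := by
  have h0 : compoundNorm k (a 0 * c 0) ≤ 1 := by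
    refine compoundNorm_le_one k ((norm_mul_le _ _).trans ?_)
    exact mul_le_one₀ ha0 (norm_nonneg _) hc0
  -- With r = (s + t)/2, write c_r a_r a_r c_r = c_(r-s) · (c_s a_s a_t c_r). This is self-adjoint,
  -- so c_(r-s) may be moved to the right end, where it completes c_r to c_t.
  have hmid : ∀ s t, 0 ≤ s → s ≤ t →
      compoundNorm k (a ((s + t) / 2) * c ((s + t) / 2)) ^ 2 ≤
        compoundNorm k (a s * c s) * compoundNorm k (a t * c t) := by
    intro s t hs hst
    set r := (s + t) / 2 with hr
    have hr0 : 0 ≤ r := by rw [hr]; linarith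
    have hd : 0 ≤ r - s := by rw [hr]; linarith
    have e1 : c r = c (r - s) * c s := by rw [← hcc _ _ hd hs]; congr 1; ring
    have e2 : c t = c r * c (r - s) := by
      rw [← hcc _ _ hr0 hd]; congr 1; rw [hr]; ring
    have e3 : a r * a r = a s * a t := by
      rw [← haa _ _ hr0 hr0, ← haa _ _ hs (hs.trans hst)]; congr 1; rw [hr]; ring
    have e4 : star (a r * c r) * (a r * c r) = c (r - s) * (c s * a s * a t * c r) := by
      rw [star_mul, (ha r).star_eq, (hc r).star_eq]
      calc c r * a r * (a r * c r) = c r * (a r * a r) * c r := by noncomm_ring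
        _ = (c (r - s) * c s) * (a s * a t) * c r := by rw [e3, ← e1]
        _ = _ := by noncomm_ring
    calc compoundNorm k (a r * c r) ^ 2
        ≤ compoundNorm k (c (r - s) * (c s * a s * a t * c r)) := by
          rw [← e4]; exact compoundNorm_sq_le k _
      _ ≤ compoundNorm k (c s * a s * a t * c r * c (r - s)) :=
          compoundNorm_mul_le_swap k (e4 ▸ IsSelfAdjoint.star_mul_self _)
      _ = compoundNorm k (star (a s * c s) * (a t * c t)) := by
          rw [e2, star_mul, (ha s).star_eq, (hc s).star_eq]; noncomm_ring
      _ ≤ compoundNorm k (star (a s * c s)) * compoundNorm k (a t * c t) :=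
          compoundNorm_mul_le k _ _
      _ = _ := by rw [compoundNorm_star]
  have hdy := le_rpow_of_midpoint (f := fun s => compoundNorm k (a s * c s))
    (fun _ => compoundNorm_nonneg _ _) h0 hmid
  obtain rfl | hs := hs0.eq_or_lt
  · simpa using h0
  -- Dyadic approximations of `s` stay in [0, 1]; the case `s = 0` was split off because continuity
  -- of the semigroups is assumed only at positive times.
  set q : ℕ → ℝ := fun n => (⌊s * 2 ^ n⌋₊ : ℝ) / 2 ^ n with hq
  have hql : Filter.Tendsto q Filter.atTop (nhds s) :=
    (tendsto_nat_floor_mul_div_atTop hs0).comp (tendsto_pow_atTop_atTop_of_one_lt one_lt_two)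
  refine compoundNorm_le_of_tendsto (l := Filter.atTop) (X := fun n => a (q n) * c (q n))
    (c := fun n => compoundNorm k (a 1 * c 1) ^ q n) ?_ ?_ (Filter.Eventually.of_forall fun n => ?_)
  · intro x y
    have h1 : Filter.Tendsto (fun n => a (q n) * c (q n)) Filter.atTop (nhds (a s * c s)) :=
      ((hac s hs).tendsto.comp hql).mul ((hcc' s hs).tendsto.comp hql)
    exact ((by fun_prop : Continuous fun X : H →L[ℂ] H => inner ℂ x (X y)).tendsto _).comp h1
  · exact (Real.continuousAt_const_rpow' hs.ne').tendsto.comp hql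
  · refine hdy n ⌊s * 2 ^ n⌋₊ ?_
    have : (⌊s * 2 ^ n⌋₊ : ℝ) ≤ 2 ^ n :=
      (Nat.floor_le (by positivity)).trans (mul_le_of_le_one_left (by positivity) hs1)
    exact_mod_cast this

end PowerInequalities

/-! ### Continuity of powers, truncated inverse powers, and the logarithmic majorization. -/

section FunctionalCalculus

variable {H : Type*} [NormedAddCommGroup H] [InnerProductSpace ℂ H]

/-- Convergence on the range of `B` extends to its closure because the operators are uniformly
bounded. -/
theorem tendsto_apply_of_mem_closure_range {ι : Type*} {l : Filter ι} {W : ι → H →L[ℂ] H}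
    {B : H →L[ℂ] H} (hW : ∀ i, ‖W i‖ ≤ 1)
    (hWB : Filter.Tendsto (fun i => W i * B) l (nhds B)) {y : H} (hy : y ∈ closure (Set.range B)) :
    Filter.Tendsto (fun i => W i y) l (nhds y) := by
  rw [Metric.tendsto_nhds]
  intro ε hε
  obtain ⟨_, ⟨u, rfl⟩, hu⟩ := Metric.mem_closure_iff.1 hy (ε / 3) (by positivity)
  have h1 : Filter.Tendsto (fun i => (W i * B) u) l (nhds (B u)) :=
    ((by fun_prop : Continuous fun X : H →L[ℂ] H => X u).tendsto B).comp hWB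
  filter_upwards [Metric.tendsto_nhds.1 h1 (ε / 3) (by positivity)] with i hi
  have h2 : dist (W i y) (W i (B u)) ≤ dist y (B u) := by
    rw [dist_eq_norm, ← map_sub, dist_eq_norm]
    exact (W i).le_of_opNorm_le (hW i) _ |>.trans (one_mul _).le
  calc dist (W i y) y ≤ dist (W i y) (W i (B u)) + dist (W i (B u)) (B u) + dist (B u) y :=
        dist_triangle4 _ _ _ _
    _ < ε / 3 + ε / 3 + ε / 3 := by
        rw [dist_comm (B u) y]
        exact add_lt_add (add_lt_add (h2.trans_lt hu) hi) hu
    _ = ε := by ring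

variable [CompleteSpace H]

theorem continuousAt_cfc_of_uncurry {a : H →L[ℂ] H} {g : ℝ → ℝ → ℝ} {s : ℝ} (hs : 0 < s)
    (hg : ContinuousOn (Function.uncurry g) (Set.Ioi 0 ×ˢ spectrum ℝ a)) :
    ContinuousAt (fun s => cfc (g s) a) s := by
  refine continuousAt_cfc_fun ?_ ?_
  · rw [Metric.tendstoUniformlyOn_iff]
    intro ε hε
    obtain ⟨v, hv, hv'⟩ := IsCompact.mem_uniformity_of_prod
      (ContinuousFunctionalCalculus.isCompact_spectrum (R := ℝ) a) hg
      (Set.mem_Ioi.2 hs) (Metric.dist_mem_uniformity hε)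
    rw [isOpen_Ioi.nhdsWithin_eq (Set.mem_Ioi.2 hs)] at hv
    filter_upwards [hv] with p hp x hx
    rw [dist_comm]
    exact hv' p hp x hx
  · filter_upwards [isOpen_Ioi.mem_nhds (Set.mem_Ioi.2 hs)] with p hp
    exact hg.comp (f := fun x => (p, x)) (by fun_prop) fun x hx => ⟨hp, hx⟩

theorem continuousAt_rpow_exponent {a : H →L[ℂ] H} (ha : 0 ≤ a) {s : ℝ} (hs : 0 < s) :
    ContinuousAt (fun s : ℝ => a ^ s) s := by
  simp_rw [CFC.rpow_eq_cfc_real ha]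
  refine continuousAt_cfc_of_uncurry hs ?_
  rintro ⟨p, x⟩ ⟨hp, -⟩
  refine ContinuousAt.continuousWithinAt ?_
  exact ContinuousAt.comp (g := fun q : ℝ × ℝ => q.1 ^ q.2) (f := fun q : ℝ × ℝ => (q.2, q.1))
    (x := (p, x)) (Real.continuousAt_rpow_of_pos (x, p) hp) (by fun_prop)

theorem rpow_add_of_nonneg {a : H →L[ℂ] H} (ha : 0 ≤ a) {s t : ℝ} (hs : 0 ≤ s) (ht : 0 ≤ t) :
    a ^ (s + t) = a ^ s * a ^ t := by
  obtain rfl | hs := hs.eq_or_lt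
  · rw [zero_add, CFC.rpow_zero a ha, one_mul]
  obtain rfl | ht := ht.eq_or_lt
  · rw [add_zero, CFC.rpow_zero a ha, mul_one]
  lift s to ℝ≥0 using hs.le
  lift t to ℝ≥0 using ht.le
  have hs' : 0 < s := by exact_mod_cast hs
  have ht' : 0 < t := by exact_mod_cast ht
  rw [← NNReal.coe_add, ← CFC.nnrpow_eq_rpow (add_pos hs' ht'), ← CFC.nnrpow_eq_rpow hs',
    ← CFC.nnrpow_eq_rpow ht', CFC.nnrpow_add hs' ht']

theorem isSelfAdjoint_rpow (a : H →L[ℂ] H) (s : ℝ) : IsSelfAdjoint (a ^ s) :=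
  IsSelfAdjoint.of_nonneg CFC.rpow_nonneg

theorem half_rpow_mul_half_rpow {a : H →L[ℂ] H} (ha : 0 ≤ a) {s : ℝ} (hs : 0 ≤ s) :
    a ^ (s / 2) * a ^ (s / 2) = a ^ s := by
  rw [← rpow_add_of_nonneg ha (by linarith) (by linarith), add_halves]

/-- The Heinz inequality with constant second semigroup 1 covers exponents in [0, 1], and
submultiplicativity the integer part. Applied to `R ^ z` with exponent 1/z it also gives the reverse
bound needed for `R`. -/
theorem compoundNorm_rpow_le (k : ℕ) {a : H →L[ℂ] H} (ha : 0 ≤ a) {p : ℝ} (hp : 0 ≤ p) :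
    compoundNorm k (a ^ p) ≤ compoundNorm k a ^ p := by
  have hN := compoundNorm_nonneg k a
  have key : ∀ s : ℝ, 0 ≤ s → s ≤ 1 → compoundNorm k (a ^ s) ≤ compoundNorm k a ^ s := by
    intro s hs hs1
    have := compoundNorm_semigroup_mul_le k (a := fun s => a ^ s) (c := fun _ => 1)
      (fun s => isSelfAdjoint_rpow a s) (fun _ => .one _)
      (by rw [CFC.rpow_zero a ha]; exact ContinuousLinearMap.norm_id_le) ContinuousLinearMap.norm_id_le
      (fun s t hs ht => rpow_add_of_nonneg ha hs ht) (fun _ _ _ _ => (one_mul 1).symm)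
      (fun s hs => continuousAt_rpow_exponent ha hs) (fun _ _ => continuousAt_const) hs hs1
    simpa only [mul_one, CFC.rpow_one a ha] using this
  have hfl : (⌊p⌋₊ : ℝ) ≤ p := Nat.floor_le hp
  have hfr := (Nat.lt_floor_add_one p).le
  have e : p = (⌊p⌋₊ : ℝ) + (p - ⌊p⌋₊) := by ring
  have h0 : 0 ≤ p - ⌊p⌋₊ := by linarith
  calc compoundNorm k (a ^ p) = compoundNorm k (a ^ ⌊p⌋₊ * a ^ (p - ⌊p⌋₊)) := by
        conv_lhs => rw [e]
        rw [rpow_add_of_nonneg ha (Nat.cast_nonneg _) h0, CFC.rpow_natCast a _ ha]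
    _ ≤ compoundNorm k (a ^ ⌊p⌋₊) * compoundNorm k (a ^ (p - ⌊p⌋₊)) := compoundNorm_mul_le k _ _
    _ ≤ compoundNorm k a ^ ⌊p⌋₊ * compoundNorm k a ^ (p - ⌊p⌋₊) :=
        mul_le_mul (compoundNorm_pow_le k a _) (key _ h0 (by linarith)) (compoundNorm_nonneg _ _)
          (by positivity)
    _ = compoundNorm k a ^ p := by
        conv_rhs => rw [e]
        rw [Real.rpow_add_of_nonneg hN (Nat.cast_nonneg _) h0, Real.rpow_natCast]

/-- A power `b⁻ˢ` regularized by truncating the spectrum of `b` from below at `ε`. -/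
noncomputable def truncatedNegPow (ε : ℝ) (b : H →L[ℂ] H) (s : ℝ) : H →L[ℂ] H :=
  cfc (fun x : ℝ => max x ε ^ (-s)) b

theorem continuous_max_rpow {ε : ℝ} (hε : 0 < ε) (s : ℝ) :
    Continuous fun x : ℝ => max x ε ^ s :=
  (by fun_prop : Continuous fun x : ℝ => max x ε).rpow_const
    fun _ => Or.inl (hε.trans_le (le_max_right _ _)).ne'

theorem isSelfAdjoint_truncatedNegPow (ε : ℝ) (b : H →L[ℂ] H) (s : ℝ) :
    IsSelfAdjoint (truncatedNegPow ε b s) :=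
  cfc_predicate _ b

theorem truncatedNegPow_zero (ε : ℝ) {b : H →L[ℂ] H} (hb : 0 ≤ b) : truncatedNegPow ε b 0 = 1 := by
  unfold truncatedNegPow
  simp only [neg_zero, Real.rpow_zero]
  exact cfc_const_one ℝ b

theorem truncatedNegPow_add {ε : ℝ} (hε : 0 < ε) (b : H →L[ℂ] H) (s t : ℝ) :
    truncatedNegPow ε b (s + t) = truncatedNegPow ε b s * truncatedNegPow ε b t := by
  unfold truncatedNegPow
  rw [← cfc_mul _ _ b (continuous_max_rpow hε _).continuousOn
    (continuous_max_rpow hε _).continuousOn]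
  congr 1
  ext x
  rw [neg_add, Real.rpow_add (hε.trans_le (le_max_right _ _))]

theorem continuousAt_truncatedNegPow {ε : ℝ} (hε : 0 < ε) (b : H →L[ℂ] H) {s : ℝ} (hs : 0 < s) :
    ContinuousAt (truncatedNegPow ε b) s := by
  refine continuousAt_cfc_of_uncurry hs (Continuous.continuousOn ?_)
  exact (by fun_prop : Continuous fun p : ℝ × ℝ => max p.2 ε).rpow
    (by fun_prop : Continuous fun p : ℝ × ℝ => -p.1)
    fun p => Or.inl (hε.trans_le (le_max_right _ _)).ne'

theorem truncatedNegPow_mul_rpow {ε : ℝ} (hε : 0 < ε) {b : H →L[ℂ] H} (hb : 0 ≤ b) {s : ℝ}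
    (hs : 0 < s) :
    truncatedNegPow ε b s * b ^ s = cfc (fun x : ℝ => max x ε ^ (-s) * x ^ s) b := by
  unfold truncatedNegPow
  rw [CFC.rpow_eq_cfc_real hb, ← cfc_mul _ _ b (continuous_max_rpow hε _).continuousOn
    (Real.continuous_rpow_const hs.le).continuousOn]

theorem isSelfAdjoint_truncatedNegPow_mul_rpow {ε : ℝ} (hε : 0 < ε) {b : H →L[ℂ] H} (hb : 0 ≤ b)
    {s : ℝ} (hs : 0 < s) : IsSelfAdjoint (truncatedNegPow ε b s * b ^ s) := by
  rw [truncatedNegPow_mul_rpow hε hb hs]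
  exact cfc_predicate _ b

theorem norm_truncatedNegPow_mul_rpow_le {ε : ℝ} (hε : 0 < ε) {b : H →L[ℂ] H} (hb : 0 ≤ b) {s : ℝ}
    (hs : 0 < s) : ‖truncatedNegPow ε b s * b ^ s‖ ≤ 1 := by
  rw [truncatedNegPow_mul_rpow hε hb hs]
  refine norm_cfc_le zero_le_one fun x hx => ?_
  have hx0 : 0 ≤ x := spectrum_nonneg_of_nonneg hb hx
  have hm : 0 < max x ε := hε.trans_le (le_max_right _ _)
  rw [Real.norm_of_nonneg (by positivity), Real.rpow_neg hm.le, inv_mul_le_iff₀ (by positivity),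
    mul_one]
  exact Real.rpow_le_rpow hx0 (le_max_left _ _) hs.le

/-- The function x ↦ max(x, ε)^(-s) x^s x^s - x^s vanishes for x ≥ ε and lies between -ε^s and 0 on
[0, ε]. -/
theorem norm_truncatedNegPow_mul_rpow_sub_le {ε : ℝ} (hε : 0 < ε) {b : H →L[ℂ] H} (hb : 0 ≤ b)
    {s : ℝ} (hs : 0 < s) : ‖truncatedNegPow ε b s * b ^ s * b ^ s - b ^ s‖ ≤ ε ^ s := by
  have hc := (Real.continuous_rpow_const (q := s) hs.le)
  have hc' : Continuous fun x : ℝ => max x ε ^ (-s) * x ^ s := (continuous_max_rpow hε _).mul hc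
  have hc'' : Continuous fun x : ℝ => max x ε ^ (-s) * x ^ s * x ^ s := hc'.mul hc
  rw [truncatedNegPow_mul_rpow hε hb hs, CFC.rpow_eq_cfc_real hb,
    ← cfc_mul _ _ b hc'.continuousOn hc.continuousOn,
    ← cfc_sub _ _ b hc''.continuousOn hc.continuousOn]
  refine norm_cfc_le (by positivity) fun x hx => ?_
  have hx0 : 0 ≤ x := spectrum_nonneg_of_nonneg hb hx
  obtain h | h := le_total ε x
  · have hx1 : 0 < x := hε.trans_le h
    rw [max_eq_left h, ← Real.rpow_add hx1, neg_add_cancel, Real.rpow_zero, one_mul, sub_self,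
      norm_zero]
    positivity
  · have h1 : ε ^ (-s) * x ^ s ≤ 1 := by
      rw [Real.rpow_neg hε.le, inv_mul_le_iff₀ (by positivity), mul_one]
      exact Real.rpow_le_rpow hx0 h hs.le
    have h2 : x ^ s ≤ ε ^ s := Real.rpow_le_rpow hx0 h hs.le
    have h3 : 0 ≤ x ^ s := by positivity
    have h4 : 0 ≤ ε ^ (-s) * x ^ s := by positivity
    rw [max_eq_right h, Real.norm_eq_abs, abs_le]
    constructor <;> nlinarith

theorem mul_supp_of_supp_le {T b : H →L[ℂ] H} (h : supp T ≤ supp b) : T * supp b = T := by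
  rw [supp_le_supp_iff] at h
  ext x
  have h1 : x - supp b x ∈ ((b.ker)ᗮ)ᗮ := Submodule.sub_starProjection_mem_orthogonal x
  have : CompleteSpace b.ker := b.isClosed_ker.completeSpace_coe
  rw [Submodule.orthogonal_orthogonal] at h1
  have h2 : T (x - supp b x) = 0 := h h1
  rw [map_sub, sub_eq_zero] at h2
  exact h2.symm

/-- These contractions vanish on ker b and converge pointwise to the identity on its orthogonal
complement, the closure of the range of `b ^ s`. -/
theorem tendsto_truncatedNegPow_mul_rpow {b : H →L[ℂ] H} (hb : 0 ≤ b) {s : ℝ} (hs : 0 < s) (x : H) :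
    Filter.Tendsto (fun n : ℕ => (truncatedNegPow (1 / ((n : ℝ) + 1)) b s * b ^ s) x)
      Filter.atTop (nhds (supp b x)) := by
  have hε : ∀ n : ℕ, (0 : ℝ) < 1 / ((n : ℝ) + 1) := fun n => by positivity
  have h1 : ∀ n : ℕ, (truncatedNegPow (1 / ((n : ℝ) + 1)) b s * b ^ s) x =
      (truncatedNegPow (1 / ((n : ℝ) + 1)) b s * b ^ s) (supp b x) := by
    intro n
    change truncatedNegPow _ b s ((b ^ s) x) = truncatedNegPow _ b s ((b ^ s) (supp b x))
    rw [apply_supp (ker_rpow hb hs)]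
  simp_rw [h1]
  refine tendsto_apply_of_mem_closure_range (B := b ^ s)
    (fun n => norm_truncatedNegPow_mul_rpow_le (hε n) hb hs) ?_
    (supp_mem_closure (ker_rpow hb hs) CFC.rpow_nonneg x)
  rw [tendsto_iff_norm_sub_tendsto_zero]
  refine squeeze_zero (fun _ => norm_nonneg _)
    (fun n => norm_truncatedNegPow_mul_rpow_sub_le (hε n) hb hs) ?_
  have := (Real.continuousAt_rpow_const 0 s (Or.inr hs.le)).tendsto.comp
    (tendsto_one_div_add_atTop_nhds_zero_nat (𝕜 := ℝ))
  rwa [Real.zero_rpow hs.ne'] at this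

/-- The logarithmic majorization behind the Araki–Lieb–Thirring inequality. -/
theorem compoundNorm_sandwich_le (k : ℕ) {a b R T : H →L[ℂ] H} (ha : 0 ≤ a) (hb : 0 ≤ b)
    (hT : 0 ≤ T) {r : ℝ} (hr : 1 ≤ r) (hR : a ^ r = b ^ (r / 2) * R * b ^ (r / 2))
    (hTb : supp T ≤ supp b) (hTa : a = b ^ (1 / 2 : ℝ) * T * b ^ (1 / 2 : ℝ)) :
    compoundNorm k T ≤ compoundNorm k R ^ (1 / r) := by
  have hr0 : 0 < r := by linarith
  have hNR := compoundNorm_nonneg k R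
  have step : ∀ ε : ℝ, 0 < ε →
      compoundNorm k ((truncatedNegPow ε b (1 / 2) * b ^ (1 / 2 : ℝ)) * T *
        (truncatedNegPow ε b (1 / 2) * b ^ (1 / 2 : ℝ))) ≤ compoundNorm k R ^ (1 / r) := by
    intro ε hε
    set C := truncatedNegPow ε b with hC
    have hCs : ∀ s, IsSelfAdjoint (C s) := isSelfAdjoint_truncatedNegPow ε b
    have hcomm : ∀ s : ℝ, 0 < s → b ^ s * C s = C s * b ^ s := by
      intro s hs
      have := (isSelfAdjoint_truncatedNegPow_mul_rpow hε hb hs).star_eq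
      rwa [star_mul, (isSelfAdjoint_rpow b s).star_eq, (hCs s).star_eq] at this
    -- Time is rescaled so that s = 1 corresponds to the exponent r/2 and s = 1/r to the exponent
    -- 1/2.
    have hheinz := compoundNorm_semigroup_mul_le k (a := fun s => a ^ (r * s / 2))
      (c := fun s => C (r * s / 2)) (fun s => isSelfAdjoint_rpow a _) (fun s => hCs _)
      (by rw [mul_zero, zero_div, CFC.rpow_zero a ha]; exact ContinuousLinearMap.norm_id_le)
      (by rw [mul_zero, zero_div, hC, truncatedNegPow_zero ε hb]; exact ContinuousLinearMap.norm_id_le)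
      (fun s t hs ht => by
        rw [← rpow_add_of_nonneg ha (by positivity) (by positivity)]; congr 1; ring)
      (fun s t hs ht => by
        rw [hC, ← truncatedNegPow_add hε]; congr 1; ring)
      (fun s hs => (continuousAt_rpow_exponent ha (by positivity)).comp
        (f := fun s : ℝ => r * s / 2) (by fun_prop))
      (fun s hs => (continuousAt_truncatedNegPow hε b (by positivity)).comp
        (f := fun s : ℝ => r * s / 2) (by fun_prop))
      (s := 1 / r) (by positivity) (by rw [div_le_one hr0]; exact hr)
    simp only [mul_one, mul_one_div_cancel hr0.ne'] at hheinz
    set x := compoundNorm k (a ^ (r / 2) * C (r / 2)) with hx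
    have hx0 : 0 ≤ x := compoundNorm_nonneg _ _
    -- Substituting the factorization of `a ^ r` puts `R` between two copies of the contraction `C
    -- (r / 2) * b ^ (r / 2)`.
    have hx2 : x ^ 2 ≤ compoundNorm k R := by
      have hcontr := compoundNorm_le_one k
        (norm_truncatedNegPow_mul_rpow_le hε hb (s := r / 2) (by positivity))
      calc x ^ 2 ≤ compoundNorm k (star (a ^ (r / 2) * C (r / 2)) * (a ^ (r / 2) * C (r / 2))) :=
            compoundNorm_sq_le k _
        _ = compoundNorm k ((C (r / 2) * b ^ (r / 2)) * R * (C (r / 2) * b ^ (r / 2))) := by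
            rw [star_mul, (hCs _).star_eq, (isSelfAdjoint_rpow a _).star_eq]
            congr 1
            calc _ = C (r / 2) * (a ^ (r / 2) * a ^ (r / 2)) * C (r / 2) := by noncomm_ring
              _ = C (r / 2) * b ^ (r / 2) * R * (b ^ (r / 2) * C (r / 2)) := by
                  rw [half_rpow_mul_half_rpow ha hr0.le, hR]; noncomm_ring
              _ = _ := by rw [hcomm _ (by positivity)]
        _ ≤ compoundNorm k (C (r / 2) * b ^ (r / 2)) * compoundNorm k R *
              compoundNorm k (C (r / 2) * b ^ (r / 2)) :=
            (compoundNorm_mul_le k _ _).trans (mul_le_mul_of_nonneg_right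
              (compoundNorm_mul_le k _ _) (compoundNorm_nonneg _ _))
        _ ≤ 1 * compoundNorm k R * 1 := by
            have := compoundNorm_nonneg k (C (r / 2) * b ^ (r / 2))
            gcongr
        _ = _ := by ring
    calc compoundNorm k ((C (1 / 2) * b ^ (1 / 2 : ℝ)) * T * (C (1 / 2) * b ^ (1 / 2 : ℝ)))
        = compoundNorm k (star (a ^ (1 / 2 : ℝ) * C (1 / 2)) * (a ^ (1 / 2 : ℝ) * C (1 / 2))) := by
          rw [star_mul, (hCs _).star_eq, (isSelfAdjoint_rpow a _).star_eq]
          congr 1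
          symm
          calc _ = C (1 / 2) * (a ^ (1 / 2 : ℝ) * a ^ (1 / 2 : ℝ)) * C (1 / 2) := by noncomm_ring
            _ = C (1 / 2) * (b ^ (1 / 2 : ℝ) * T * b ^ (1 / 2 : ℝ)) * C (1 / 2) := by
                rw [half_rpow_mul_half_rpow ha zero_le_one, CFC.rpow_one a ha, ← hTa]
            _ = C (1 / 2) * b ^ (1 / 2 : ℝ) * T * (b ^ (1 / 2 : ℝ) * C (1 / 2)) := by noncomm_ring
            _ = _ := by rw [hcomm _ (by positivity)]
      _ ≤ compoundNorm k (a ^ (1 / 2 : ℝ) * C (1 / 2)) ^ 2 := by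
          rw [sq]
          refine (compoundNorm_mul_le k _ _).trans_eq ?_
          rw [compoundNorm_star]
      _ ≤ (x ^ (1 / r)) ^ 2 := by
          have := compoundNorm_nonneg k (a ^ (1 / 2 : ℝ) * C (1 / 2))
          gcongr
      _ = (x ^ 2) ^ (1 / r) := by
          rw [← Real.rpow_natCast, ← Real.rpow_natCast, ← Real.rpow_mul hx0, ← Real.rpow_mul hx0,
            mul_comm]
      _ ≤ compoundNorm k R ^ (1 / r) := by gcongr
  refine compoundNorm_le_of_tendsto (l := Filter.atTop)
    (X := fun n : ℕ => (truncatedNegPow (1 / ((n : ℝ) + 1)) b (1 / 2) * b ^ (1 / 2 : ℝ)) * T *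
        (truncatedNegPow (1 / ((n : ℝ) + 1)) b (1 / 2) * b ^ (1 / 2 : ℝ)))
    (fun x y => ?_) tendsto_const_nhds
    (Filter.Eventually.of_forall fun n => step _ (by positivity))
  have hTS := mul_supp_of_supp_le hTb
  -- The support condition on `T` is used here: the truncated sandwiches converge weakly to the
  -- compression of `T` by `supp b`, which is `T` itself.
  have hlim : inner ℂ x (T y) = inner ℂ (supp b x) (T (supp b y)) := by
    have h1 : T (supp b y) = T y := congrArg (fun F : H →L[ℂ] H => F y) hTS
    have hTa' : ∀ u v, inner ℂ (T u) v = inner ℂ u (T v) := fun u v => by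
      conv_rhs => rw [← (IsSelfAdjoint.of_nonneg hT).adjoint_eq]
      rw [ContinuousLinearMap.adjoint_inner_right]
    have h2 : T (supp b x) = T x := congrArg (fun F : H →L[ℂ] H => F x) hTS
    rw [h1, ← hTa', ← hTa', h2]
  rw [hlim]
  have hWx := tendsto_truncatedNegPow_mul_rpow hb (s := 1 / 2) (by norm_num) x
  have hWy := tendsto_truncatedNegPow_mul_rpow hb (s := 1 / 2) (by norm_num) y
  refine (hWx.inner ((T.continuous.tendsto _).comp hWy)).congr fun n => ?_
  have hsa := (isSelfAdjoint_truncatedNegPow_mul_rpow (ε := 1 / ((n : ℝ) + 1)) (by positivity) hb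
    (s := 1 / 2) (by norm_num)).adjoint_eq
  rw [← ContinuousLinearMap.adjoint_inner_right, hsa]
  rfl

end FunctionalCalculus

/-! ### From compound norms to traces through finite-dimensional compressions. -/

section TraceComparison

/-- Summation by parts, carried out as an induction. -/
theorem mul_sum_le_sum_mul_of_antitone {m d : ℕ → ℝ} (hm : Antitone m)
    (hd : ∀ k, 0 ≤ ∑ i ∈ Finset.range k, d i) (n : ℕ) :
    m n * ∑ i ∈ Finset.range (n + 1), d i ≤ ∑ i ∈ Finset.range (n + 1), m i * d i := by
  induction n with
  | zero => simp
  | succ n ih =>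
    rw [Finset.sum_range_succ, Finset.sum_range_succ _ (n + 1), mul_add]
    have := mul_le_mul_of_nonneg_right (hm n.le_succ) (hd (n + 1))
    exact add_le_add_left (this.trans ih) _

/-- Weak logarithmic majorization implies weak majorization. -/
theorem sum_le_sum_of_prod_le_prod {m ν : ℕ → ℝ} (hm : Antitone m) (hm0 : ∀ i, 0 ≤ m i)
    (hν0 : ∀ i, 0 ≤ ν i) (n : ℕ)
    (h : ∀ k ≤ n, ∏ i ∈ Finset.range k, m i ≤ ∏ i ∈ Finset.range k, ν i) :
    ∑ i ∈ Finset.range n, m i ≤ ∑ i ∈ Finset.range n, ν i := by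
  induction n with
  | zero => simp
  | succ n ih =>
    obtain h0 | hpos := (hm0 n).eq_or_lt
    · rw [Finset.sum_range_succ, Finset.sum_range_succ, ← h0]
      exact add_le_add (ih fun k hk => h k (by omega)) (hν0 n)
    have hmi : ∀ i ≤ n, 0 < m i := fun i hi => hpos.trans_le (hm hi)
    have hνi : ∀ i ≤ n, 0 < ν i := by
      intro i hi
      refine (hν0 i).lt_of_ne' fun h0 => ?_
      have h1 : 0 < ∏ j ∈ Finset.range (n + 1), m j :=
        Finset.prod_pos fun j hj => hmi j (by rw [Finset.mem_range] at hj; omega)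
      have h2 := h (n + 1) le_rfl
      rw [Finset.prod_eq_zero (Finset.mem_range.2 (Nat.lt_succ_of_le hi)) h0] at h2
      linarith
    -- The partial sums of log (ν i / m i) are nonnegative by the product hypothesis, so summation
    -- by parts gives 0 ≤ ∑ m i * d i; then log t ≤ t - 1 bounds each term by ν i - m i. Extension
    -- by zero keeps all later partial sums nonnegative.
    set d : ℕ → ℝ := fun i => if i ≤ n then Real.log (ν i / m i) else 0 with hd
    have hsum : ∀ k ≤ n + 1, 0 ≤ ∑ i ∈ Finset.range k, d i := by
      intro k hk
      have e : ∑ i ∈ Finset.range k, d i = Real.log (∏ i ∈ Finset.range k, ν i / m i) := by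
        rw [Real.log_prod]
        · refine Finset.sum_congr rfl fun i hi => ?_
          rw [Finset.mem_range] at hi
          rw [hd]
          exact if_pos (by omega)
        · intro i hi
          rw [Finset.mem_range] at hi
          exact (div_pos (hνi i (by omega)) (hmi i (by omega))).ne'
      rw [e, Finset.prod_div_distrib]
      refine Real.log_nonneg ?_
      rw [one_le_div (Finset.prod_pos fun j hj => hmi j (by rw [Finset.mem_range] at hj; omega))]
      exact h k hk
    have hall : ∀ k, 0 ≤ ∑ i ∈ Finset.range k, d i := by
      intro k
      obtain hk | hk := le_total k (n + 1)
      · exact hsum k hk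
      · obtain ⟨j, rfl⟩ := Nat.exists_eq_add_of_le hk
        rw [Finset.sum_range_add, Finset.sum_eq_zero (s := Finset.range j), add_zero]
        · exact hsum _ le_rfl
        · intro i _
          exact if_neg (by omega)
    have h1 := mul_sum_le_sum_mul_of_antitone hm hall n
    have h2 : 0 ≤ ∑ i ∈ Finset.range (n + 1), m i * d i :=
      (mul_nonneg (hm0 n) (hall _)).trans h1
    have h3 : ∑ i ∈ Finset.range (n + 1), m i * d i ≤
        ∑ i ∈ Finset.range (n + 1), (ν i - m i) := by
      refine Finset.sum_le_sum fun i hi => ?_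
      rw [Finset.mem_range] at hi
      have hi' : i ≤ n := by omega
      have hm' := hmi i hi'
      have h4 : d i = Real.log (ν i / m i) := if_pos hi'
      have h5 := Real.log_le_sub_one_of_pos (div_pos (hνi i hi') hm')
      calc m i * d i ≤ m i * (ν i / m i - 1) := by rw [h4]; gcongr
        _ = ν i - m i := by field_simp
    rw [Finset.sum_sub_distrib] at h3
    linarith

variable {H : Type*} [NormedAddCommGroup H] [InnerProductSpace ℂ H]

/-- The compression of `A` to a finite-dimensional subspace. -/
noncomputable def compression (A : H →L[ℂ] H) (V : Submodule ℂ H) [FiniteDimensional ℂ V] :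
    V →ₗ[ℂ] V :=
  (V.orthogonalProjectionOnto ∘L A ∘L V.subtypeL : V →L[ℂ] V)

theorem inner_compression (A : H →L[ℂ] H) (V : Submodule ℂ H) [FiniteDimensional ℂ V] (x y : V) :
    inner ℂ x (compression A V y) = inner ℂ (x : H) (A y) :=
  Submodule.inner_orthogonalProjectionOnto_eq_of_mem_left x (A y)

theorem re_inner_apply_nonneg {A : H →L[ℂ] H} (hA : 0 ≤ A) (x : H) : 0 ≤ (inner ℂ x (A x)).re :=
  ((ContinuousLinearMap.nonneg_iff_isPositive A).1 hA).re_inner_nonneg_right x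

variable [CompleteSpace H]

theorem compression_isSymmetric {A : H →L[ℂ] H} (hA : 0 ≤ A) (V : Submodule ℂ H)
    [FiniteDimensional ℂ V] : (compression A V).IsSymmetric := by
  intro x y
  rw [inner_compression, ← inner_conj_symm, inner_compression, inner_conj_symm]
  conv_rhs => rw [← (IsSelfAdjoint.of_nonneg hA).adjoint_eq]
  rw [ContinuousLinearMap.adjoint_inner_right]

open Classical in
/-- The eigenvalues of the compression of `A` to `V`, in decreasing order, continued by zero. -/
noncomputable def compressionEigenvalue {A : H →L[ℂ] H} (hA : 0 ≤ A) (V : Submodule ℂ H)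
    [FiniteDimensional ℂ V] (i : ℕ) : ℝ :=
  if h : i < Module.finrank ℂ V then (compression_isSymmetric hA V).eigenvalues rfl ⟨i, h⟩ else 0

section Eigenvalues

variable {A : H →L[ℂ] H} (hA : 0 ≤ A) (V : Submodule ℂ H) [FiniteDimensional ℂ V]

/-- An orthonormal basis of `V` diagonalizing the compression of `A`. -/
noncomputable def compressionBasis : OrthonormalBasis (Fin (Module.finrank ℂ V)) ℂ V :=
  (compression_isSymmetric hA V).eigenvectorBasis rfl

theorem compressionEigenvalue_fin {n : ℕ} (hn : Module.finrank ℂ V = n) (i : Fin n) :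
    compressionEigenvalue hA V i = (compression_isSymmetric hA V).eigenvalues hn i := by
  subst hn
  exact dif_pos i.2

theorem inner_compressionBasis (i j : Fin (Module.finrank ℂ V)) :
    inner ℂ (compressionBasis hA V i : H) (A (compressionBasis hA V j)) =
      if i = j then (compressionEigenvalue hA V j : ℂ) else 0 := by
  rw [← inner_compression, compressionEigenvalue_fin hA V rfl]
  unfold compressionBasis
  rw [(compression_isSymmetric hA V).apply_eigenvectorBasis, inner_smul_right,
    orthonormal_iff_ite.1 (OrthonormalBasis.orthonormal _)]
  simp

theorem compressionEigenvalue_of_le {i : ℕ} (h : Module.finrank ℂ V ≤ i) :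
    compressionEigenvalue hA V i = 0 :=
  dif_neg h.not_gt

theorem compressionEigenvalue_nonneg (i : ℕ) : 0 ≤ compressionEigenvalue hA V i := by
  by_cases h : i < Module.finrank ℂ V
  · have h1 := inner_compressionBasis hA V ⟨i, h⟩ ⟨i, h⟩
    have h2 := re_inner_apply_nonneg hA (compressionBasis hA V ⟨i, h⟩ : H)
    rw [h1] at h2
    simpa using h2
  · exact (compressionEigenvalue_of_le hA V (not_lt.1 h)).ge

theorem compressionEigenvalue_antitone : Antitone (compressionEigenvalue hA V) := by
  intro i j hij
  by_cases h : j < Module.finrank ℂ V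
  · have := (compression_isSymmetric hA V).eigenvalues_antitone rfl
      (show (⟨i, hij.trans_lt h⟩ : Fin _) ≤ ⟨j, h⟩ from hij)
    rwa [← compressionEigenvalue_fin, ← compressionEigenvalue_fin] at this
  · exact (compressionEigenvalue_of_le hA V (not_lt.1 h)).trans_le
      (compressionEigenvalue_nonneg hA V i)

theorem re_inner_eq_sum_eigenvalue (x : V) :
    (inner ℂ (x : H) (A x)).re = ∑ i : Fin (Module.finrank ℂ V),
      compressionEigenvalue hA V i * ‖inner ℂ (compressionBasis hA V i) x‖ ^ 2 := by
  have h : inner ℂ (x : H) (A x) = ∑ i : Fin (Module.finrank ℂ V),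
      ((compressionEigenvalue hA V i * ‖inner ℂ (compressionBasis hA V i) x‖ ^ 2 : ℝ) : ℂ) := by
    rw [← inner_compression, ← OrthonormalBasis.sum_inner_mul_inner (compressionBasis hA V)]
    refine Finset.sum_congr rfl fun i _ => ?_
    rw [← compression_isSymmetric hA V, compressionEigenvalue_fin hA V rfl]
    unfold compressionBasis
    rw [(compression_isSymmetric hA V).apply_eigenvectorBasis, inner_smul_left, ← inner_conj_symm x,
      mul_left_comm, Complex.conj_mul']
    simp
  rw [h, Complex.re_sum]
  simp only [Complex.ofReal_re]

theorem sum_eigenvalue_eq {ι : Type*} [Fintype ι] (e : OrthonormalBasis ι ℂ V) :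
    ∑ i ∈ Finset.range (Module.finrank ℂ V), compressionEigenvalue hA V i =
      ∑ i, (inner ℂ (e i : H) (A (e i))).re := by
  rw [← Fin.sum_univ_eq_sum_range]
  have h1 := (compression A V).trace_eq_sum_inner e
  have h2 := (compression A V).trace_eq_sum_inner (compressionBasis hA V)
  rw [h1] at h2
  have h3 := congrArg Complex.re h2
  simp only [inner_compression, Complex.re_sum, inner_compressionBasis, if_true,
    Complex.ofReal_re] at h3
  exact h3.symm

theorem prod_eigenvalue_eq {k : ℕ} {v : Fin k → H} (hv : Orthonormal ℂ v)
    [FiniteDimensional ℂ (Submodule.span ℂ (Set.range v))] :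
    (∏ i ∈ Finset.range k,
      compressionEigenvalue hA (Submodule.span ℂ (Set.range v)) i : ℝ) =
        (formMatrix v A v).det := by
  set U := Submodule.span ℂ (Set.range v) with hU
  have hk : Module.finrank ℂ U = k := by
    rw [hU, finrank_span_eq_card hv.linearIndependent, Fintype.card_fin]
  set b := Module.Basis.span hv.linearIndependent with hb
  have hbv : ∀ i, (b i : H) = v i := fun i => by
    rw [hb, Module.Basis.span_apply]
  have hbo : Orthonormal ℂ b := by
    rw [← U.subtypeₗᵢ.orthonormal_comp_iff]
    convert hv
    ext i
    exact hbv i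
  set e := b.toOrthonormalBasis hbo
  have hdet : (formMatrix v A v) = LinearMap.toMatrix e.toBasis e.toBasis (compression A U) := by
    ext i j
    rw [LinearMap.toMatrix_apply, OrthonormalBasis.coe_toBasis_repr_apply,
      OrthonormalBasis.repr_apply_apply, OrthonormalBasis.coe_toBasis, inner_compression]
    simp only [e, Module.Basis.coe_toOrthonormalBasis, hbv]
    rfl
  rw [hdet, LinearMap.det_toMatrix, (compression_isSymmetric hA U).det_eq_prod_eigenvalues hk,
    ← Fin.prod_univ_eq_prod_range]
  rw [Complex.ofReal_prod]
  exact Finset.prod_congr rfl fun i _ => congrArg _ (compressionEigenvalue_fin hA U hk i)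

/-- The first k eigenvectors diagonalize the form, so the product is one of the determinants in the
supremum; for k > dim V a padded zero occurs. -/
theorem prod_eigenvalue_le_compoundNorm (k : ℕ) :
    ∏ i ∈ Finset.range k, compressionEigenvalue hA V i ≤ compoundNorm k A := by
  obtain hk | hk := le_or_gt k (Module.finrank ℂ V)
  · set w : Fin k → H := fun i => compressionBasis hA V (Fin.castLE hk i) with hw
    have hwo : Orthonormal ℂ w :=
      ((compressionBasis hA V).orthonormal.comp_linearIsometry V.subtypeₗᵢ).comp _
        (Fin.castLE_injective hk)
    have hm : formMatrix w A w =
        Matrix.diagonal fun i : Fin k => (compressionEigenvalue hA V i : ℂ) := by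
      ext i j
      rw [Matrix.diagonal_apply]
      refine (inner_compressionBasis hA V _ _).trans ?_
      by_cases hij : i = j
      · subst hij; simp
      · simp [hij]
    have := norm_det_le_compoundNorm hwo hwo A
    rw [hm, Matrix.det_diagonal, norm_prod] at this
    rw [← Fin.prod_univ_eq_prod_range]
    refine le_trans (le_of_eq (Finset.prod_congr rfl fun i _ => ?_)) this
    rw [Complex.norm_real, Real.norm_of_nonneg (compressionEigenvalue_nonneg hA V i)]
  · rw [Finset.prod_eq_zero (Finset.mem_range.2 hk) (compressionEigenvalue_of_le hA V le_rfl)]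
    exact compoundNorm_nonneg k A

/-- Cauchy interlacing, in the form of monotonicity in the subspace. -/
theorem compressionEigenvalue_mono {W : Submodule ℂ H} [FiniteDimensional ℂ W] (hVW : V ≤ W)
    (i : ℕ) : compressionEigenvalue hA V i ≤ compressionEigenvalue hA W i := by
  by_cases hi : i < Module.finrank ℂ V
  swap
  · exact (compressionEigenvalue_of_le hA V (not_lt.1 hi)).trans_le
      (compressionEigenvalue_nonneg hA W i)
  have hiW : i < Module.finrank ℂ W := hi.trans_le (Submodule.finrank_mono hVW)
  -- Courant–Fischer by counting: the eigenvectors of index above i in V and below i in W impose dim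
  -- V - 1 conditions, so some nonzero x in V satisfies them all. On it the form is at least the
  -- i-th eigenvalue for V and at most that for W.
  let ι := {j : Fin (Module.finrank ℂ V) // ⟨i, hi⟩ < j} ⊕
    {l : Fin (Module.finrank ℂ W) // l < ⟨i, hiW⟩}
  let Φ : V →ₗ[ℂ] (ι → ℂ) := LinearMap.pi fun s => Sum.elim
    (fun j => (innerSL ℂ (compressionBasis hA V j.1)).toLinearMap)
    (fun l => (innerSL ℂ (compressionBasis hA W l.1)).toLinearMap ∘ₗ Submodule.inclusion hVW) s
  have hcard : Module.finrank ℂ (ι → ℂ) < Module.finrank ℂ V := by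
    rw [Module.finrank_fintype_fun_eq_card, Fintype.card_sum, Fintype.card_subtype,
      Fintype.card_subtype, Finset.filter_lt_eq_Ioi, Finset.filter_gt_eq_Iio, Fin.card_Ioi,
      Fin.card_Iio]
    dsimp only
    omega
  obtain ⟨x, hx, hx0⟩ := Submodule.exists_mem_ne_zero_of_ne_bot
    (LinearMap.ker_ne_bot_of_finrank_lt (f := Φ) hcard)
  have hxV : ∀ j : Fin (Module.finrank ℂ V), ⟨i, hi⟩ < j →
      inner ℂ (compressionBasis hA V j) x = 0 := fun j hj => congrFun hx (Sum.inl ⟨j, hj⟩)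
  have hxW : ∀ l : Fin (Module.finrank ℂ W), l < ⟨i, hiW⟩ →
      inner ℂ (compressionBasis hA W l) (Submodule.inclusion hVW x) = 0 :=
    fun l hl => congrFun hx (Sum.inr ⟨l, hl⟩)
  have h1 : compressionEigenvalue hA V i * ‖x‖ ^ 2 ≤ (inner ℂ (x : H) (A x)).re := by
    rw [re_inner_eq_sum_eigenvalue hA V x,
      ← (compressionBasis hA V).sum_sq_norm_inner_right x, Finset.mul_sum]
    refine Finset.sum_le_sum fun j _ => ?_
    obtain hj | hj := le_or_gt j ⟨i, hi⟩
    · exact mul_le_mul_of_nonneg_right (compressionEigenvalue_antitone hA V hj) (by positivity)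
    · rw [hxV j hj]; simp
  have h2 : (inner ℂ (x : H) (A x)).re ≤ compressionEigenvalue hA W i * ‖x‖ ^ 2 := by
    have hn : ‖x‖ = ‖Submodule.inclusion hVW x‖ := rfl
    refine (re_inner_eq_sum_eigenvalue hA W (Submodule.inclusion hVW x)).trans_le ?_
    rw [hn, ← (compressionBasis hA W).sum_sq_norm_inner_right (Submodule.inclusion hVW x),
      Finset.mul_sum]
    refine Finset.sum_le_sum fun l _ => ?_
    obtain hl | hl := lt_or_ge l ⟨i, hiW⟩
    · rw [hxW l hl]; simp
    · exact mul_le_mul_of_nonneg_right (compressionEigenvalue_antitone hA W hl) (by positivity)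
  have hpos : 0 < ‖x‖ ^ 2 := by have := norm_pos_iff.2 hx0; positivity
  exact le_of_mul_le_mul_right (h1.trans h2) hpos

/-- An orthonormal basis of V extends to a Hilbert basis of H, and the trace is independent of the
basis. -/
theorem sum_eigenvalue_le_trace :
    ENNReal.ofReal (∑ i ∈ Finset.range (Module.finrank ℂ V), compressionEigenvalue hA V i) ≤
      trace A := by
  set w : Fin (Module.finrank ℂ V) → H := fun i => compressionBasis hA V i
  have hw : Orthonormal ℂ w :=
    (compressionBasis hA V).orthonormal.comp_linearIsometry V.subtypeₗᵢ
  obtain ⟨s, b, hs, hb⟩ := hw.toSubtypeRange.exists_hilbertBasis_extension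
  rw [trace_eq b hA, sum_eigenvalue_eq hA V (compressionBasis hA V),
    ENNReal.ofReal_sum_of_nonneg fun i _ => re_inner_apply_nonneg hA _, ← tsum_fintype (L := .unconditional _)]
  have hinj : Function.Injective fun i => (⟨w i, hs ⟨i, rfl⟩⟩ : s) := fun i j hij =>
    hw.linearIndependent.injective (Subtype.mk.inj hij)
  refine le_trans (le_of_eq ?_) (ENNReal.tsum_comp_le_tsum_of_injective hinj _)
  simp only [hb]
  rfl

/-- For positive operators, families with u = v suffice to compute the norm, and their determinants
are eigenvalue products for the span. The factor c^k > 1 replaces attainment of the supremum. -/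
theorem exists_submodule_compoundNorm_le (k : ℕ) {c : ℝ} (hc : 1 < c) :
    ∃ (U : Submodule ℂ H) (_ : FiniteDimensional ℂ U),
      compoundNorm k A ≤ c ^ k * ∏ i ∈ Finset.range k, compressionEigenvalue hA U i := by
  have hN := compoundNorm_nonneg k A
  have hck : 0 < c ^ k := by positivity
  by_contra! hcon
  have hlt : ∀ v : Fin k → H, Orthonormal ℂ v →
      c ^ k * ‖(formMatrix v A v).det‖ < compoundNorm k A := by
    intro v hv
    have : FiniteDimensional ℂ (Submodule.span ℂ (Set.range v)) :=
      FiniteDimensional.span_of_finite ℂ (Set.finite_range v)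
    have h1 := hcon _ this
    rwa [← prod_eigenvalue_eq hA hv, Complex.norm_real, Real.norm_of_nonneg
      (Finset.prod_nonneg fun i _ => compressionEigenvalue_nonneg hA _ i)]
  have h2 : compoundNorm k A ≤ compoundNorm k A / c ^ k :=
    compoundNorm_le_of_nonneg hA (by positivity) fun v hv => by
      rw [le_div_iff₀' hck]
      exact (hlt v hv).le
  have h3 := hcon ⊥ inferInstance
  have h4 : 0 ≤ ∏ i ∈ Finset.range k, compressionEigenvalue hA (⊥ : Submodule ℂ H) i :=
    Finset.prod_nonneg fun i _ => compressionEigenvalue_nonneg hA _ i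
  have hpos : 0 < compoundNorm k A := (mul_nonneg hck.le h4).trans_lt h3
  obtain rfl | hk := k.eq_zero_or_pos
  · have := compoundNorm_le (X := A) zero_le_one (k := 0) fun u v _ _ => by
      rw [Matrix.det_isEmpty, norm_one]
    rw [pow_zero, Finset.range_zero, Finset.prod_empty] at h3
    linarith
  · have h5 : 1 < c ^ k := one_lt_pow₀ hc hk.ne'
    rw [le_div_iff₀ hck] at h2
    nlinarith

end Eigenvalues

/-- Domination of all compound norms implies domination of the traces. -/
theorem trace_le_of_compoundNorm_le {A B : H →L[ℂ] H} (hA : 0 ≤ A) (hB : 0 ≤ B)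
    (h : ∀ k, compoundNorm k A ≤ compoundNorm k B) : trace A ≤ trace B := by
  by_cases hfin : trace B = ⊤
  · rw [hfin]; exact le_top
  have key : ∀ (V : Submodule ℂ H) [FiniteDimensional ℂ V],
      ∑ i ∈ Finset.range (Module.finrank ℂ V), compressionEigenvalue hA V i ≤
        (trace B).toReal := by
    intro V _
    set n := Module.finrank ℂ V
    have hc : ∀ c : ℝ, 1 < c → ∑ i ∈ Finset.range n, compressionEigenvalue hA V i ≤
        c * (trace B).toReal := by
      intro c hc
      -- One nearly optimal subspace for each k ≤ n; by interlacing, their sum W serves all k at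
      -- once. The slack c^k is absorbed by multiplying every eigenvalue by c, and c tends to 1 at
      -- the end.
      choose U hU hUB using fun k : Fin (n + 1) =>
        exists_submodule_compoundNorm_le (hA := hB) k hc
      set W : Submodule ℂ H := ⨆ k, U k
      have hν0 := compressionEigenvalue_nonneg hB W
      have hc0 : 0 ≤ c := by linarith
      have hmaj : ∑ i ∈ Finset.range n, compressionEigenvalue hA V i ≤
          ∑ i ∈ Finset.range n, c * compressionEigenvalue hB W i := by
        refine sum_le_sum_of_prod_le_prod (compressionEigenvalue_antitone hA V)
          (compressionEigenvalue_nonneg hA V) (fun i => mul_nonneg hc0 (hν0 i)) n fun k hk => ?_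
        rw [Finset.prod_mul_distrib, Finset.prod_const, Finset.card_range]
        calc _ ≤ compoundNorm k A := prod_eigenvalue_le_compoundNorm hA V k
          _ ≤ compoundNorm k B := h k
          _ ≤ c ^ k * ∏ i ∈ Finset.range k,
                compressionEigenvalue hB (U ⟨k, Nat.lt_succ_of_le hk⟩) i :=
              hUB ⟨k, Nat.lt_succ_of_le hk⟩
          _ ≤ _ := by
              refine mul_le_mul_of_nonneg_left ?_ (by positivity)
              exact Finset.prod_le_prod (fun i _ => compressionEigenvalue_nonneg hB _ i)
                fun i _ => compressionEigenvalue_mono hB _ (le_iSup U _) i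
      rw [← Finset.mul_sum] at hmaj
      refine hmaj.trans (mul_le_mul_of_nonneg_left ?_ hc0)
      have h1 := ENNReal.toReal_mono hfin (sum_eigenvalue_le_trace hB W)
      rw [ENNReal.toReal_ofReal (Finset.sum_nonneg fun i _ => hν0 i)] at h1
      refine le_trans ?_ h1
      obtain hn | hn := le_total n (Module.finrank ℂ W)
      · exact Finset.sum_le_sum_of_subset_of_nonneg (Finset.range_mono hn) fun i _ _ => hν0 i
      · refine (Finset.sum_subset (Finset.range_mono hn) fun i _ hi => ?_).ge
        exact compressionEigenvalue_of_le hB W (by rwa [Finset.mem_range, not_lt] at hi)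
    have hlim : Filter.Tendsto (fun c : ℝ => c * (trace B).toReal) (nhdsWithin 1 (Set.Ioi 1))
        (nhds (1 * (trace B).toReal)) :=
      ((continuous_mul_const _).tendsto 1).mono_left nhdsWithin_le_nhds
    rw [one_mul] at hlim
    exact ge_of_tendsto hlim (Filter.eventually_of_mem self_mem_nhdsWithin fun c h => hc c h)
  unfold trace
  set b := (exists_hilbertBasis ℂ H).choose_spec.choose
  rw [ENNReal.tsum_eq_iSup_sum]
  -- Each finite partial sum of the trace is the trace of the compression to the span of the basis
  -- vectors involved.
  refine iSup_le fun s => ?_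
  rw [← ENNReal.ofReal_sum_of_nonneg fun i _ => re_inner_apply_nonneg hA _]
  refine ENNReal.ofReal_le_of_le_toReal ?_
  classical
  set e := OrthonormalBasis.span b.orthonormal s
  have : FiniteDimensional ℂ (Submodule.span ℂ (s.image b : Set H)) :=
    FiniteDimensional.span_finset ℂ _
  refine le_trans (le_of_eq ?_) (key (Submodule.span ℂ (s.image b : Set H)))
  rw [sum_eigenvalue_eq hA _ e, ← Finset.sum_coe_sort]
  refine Finset.sum_congr rfl fun i _ => ?_
  rw [OrthonormalBasis.span_apply]

end TraceComparison

/-! ### Factorization, the Araki–Lieb–Thirring inequality, and monotonicity in z. -/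

section Monotonicity

variable {H : Type*} [NormedAddCommGroup H] [InnerProductSpace ℂ H] [CompleteSpace H]

/-- The Douglas factorization for an operator dominated by a positive one. -/
theorem exists_eq_conj_of_le {a b : H →L[ℂ] H} (ha : 0 ≤ a) (hb : 0 ≤ b) {c : ℝ}
    (h : a ≤ c • b) : ∃ R : H →L[ℂ] H, a = b ^ (1 / 2 : ℝ) * R * b ^ (1 / 2 : ℝ) := by
  set A := a ^ (1 / 2 : ℝ)
  set B := b ^ (1 / 2 : ℝ)
  have hAs : star A = A := (isSelfAdjoint_rpow a _).star_eq
  have hBs : star B = B := (isSelfAdjoint_rpow b _).star_eq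
  have hAA : A * A = a := by
    rw [half_rpow_mul_half_rpow ha zero_le_one, CFC.rpow_one a ha]
  have hBB : B * B = b := by
    rw [half_rpow_mul_half_rpow hb zero_le_one, CFC.rpow_one b hb]
  have hsq : ∀ (X : H →L[ℂ] H), star X = X → ∀ x, ‖X x‖ ^ 2 = (inner ℂ x ((X * X) x)).re := by
    intro X hX x
    change _ = (inner ℂ x (X (X x))).re
    rw [← ContinuousLinearMap.adjoint_inner_left, ← ContinuousLinearMap.star_eq_adjoint, hX,
      inner_self_eq_norm_sq_to_K]
    simp [← Complex.ofReal_pow]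
  have hle : ∀ x, ‖A x‖ ^ 2 ≤ c * ‖B x‖ ^ 2 := by
    intro x
    rw [hsq A hAs, hsq B hBs, hAA, hBB]
    have h1 := re_inner_apply_nonneg (sub_nonneg.2 h) x
    have h2 : inner ℂ x ((c • b - a) x) = (c : ℂ) * inner ℂ x (b x) - inner ℂ x (a x) := by
      rw [sub_apply, inner_sub_right, smul_apply, inner_smul_right_eq_smul]
      simp
    rw [h2, Complex.sub_re, Complex.re_ofReal_mul] at h1
    linarith
  set V : Submodule ℂ H := B.range.topologicalClosure with hV
  have : CompleteSpace V := B.range.isClosed_topologicalClosure.completeSpace_coe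
  let e : H →ₗ[ℂ] V :=
    B.toLinearMap.codRestrict V fun x => B.range.le_topologicalClosure ⟨x, rfl⟩
  have hdense : DenseRange e := by
    intro y
    rw [mem_closure_iff_seq_limit]
    obtain ⟨s, hs, hlim⟩ := mem_closure_iff_seq_limit.1
      (show (y : H) ∈ closure (B.range : Set H) from y.2)
    choose u hu using hs
    refine ⟨fun n => e (u n), fun n => ⟨u n, rfl⟩, ?_⟩
    rw [tendsto_subtype_rng]
    exact hlim.congr fun n => (hu n).symm
  -- This makes B x ↦ A x well defined and bounded on the range of B. The absolute value appears
  -- because `c` carries no sign assumption.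
  have hbd : ∀ x, ‖A.toLinearMap x‖ ≤ √|c| * ‖e x‖ := by
    intro x
    refine le_of_sq_le_sq ?_ (by positivity)
    rw [mul_pow, Real.sq_sqrt (abs_nonneg c)]
    exact (hle x).trans (mul_le_mul_of_nonneg_right (le_abs_self c) (sq_nonneg _))
  let K : H →L[ℂ] H := A.toLinearMap.extendOfNorm e ∘L V.orthogonalProjectionOnto
  have hK : K * B = A := by
    ext x
    change A.toLinearMap.extendOfNorm e (V.orthogonalProjectionOnto (e x : V)) = A x
    rw [Submodule.orthogonalProjectionOnto_mem_subspace_eq_self]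
    exact LinearMap.extendOfNorm_eq hdense ⟨_, hbd⟩ x
  refine ⟨star K * K, ?_⟩
  calc a = star A * A := by rw [hAs, hAA]
    _ = star (K * B) * (K * B) := by rw [hK]
    _ = _ := by rw [star_mul, hBs]; noncomm_ring

theorem smul_rpow {b : H →L[ℂ] H} (hb : 0 ≤ b) {c r s : ℝ} (hc : 0 ≤ c) (hr : 0 < r) (hs : 0 < s) :
    (c • b ^ r) ^ s = c ^ s • b ^ (r * s) := by
  have hcr := (Real.continuous_rpow_const (q := r) hr.le).continuousOn (s := spectrum ℝ b)
  have hcs := Real.continuous_rpow_const (q := s) hs.le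
  have hrs : 0 < r * s := mul_pos hr hs
  rw [CFC.rpow_eq_cfc_real (smul_nonneg hc CFC.rpow_nonneg), CFC.rpow_eq_cfc_real hb,
    CFC.rpow_eq_cfc_real hb, ← cfc_smul c _ b hcr,
    ← cfc_comp' (fun x : ℝ => x ^ s) (fun x : ℝ => c • x ^ r) b hcs.continuousOn
      (hcr.const_smul c),
    ← cfc_smul (c ^ s) _ b (Real.continuous_rpow_const hrs.le).continuousOn]
  refine cfc_congr fun x hx => ?_
  have hx0 : 0 ≤ x := spectrum_nonneg_of_nonneg hb hx
  rw [smul_eq_mul, smul_eq_mul, Real.mul_rpow hc (by positivity), Real.rpow_mul hx0]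

/-- A factorization of `a ^ r` through `b ^ r` with `1 ≤ r` yields one of `a` through `b`. -/
theorem exists_eq_conj_of_rpow {a b R : H →L[ℂ] H} (ha : 0 ≤ a) (hb : 0 ≤ b) (hR0 : 0 ≤ R) {r : ℝ}
    (hr : 1 ≤ r) (hR : a ^ r = b ^ (r / 2) * R * b ^ (r / 2)) :
    ∃ T : H →L[ℂ] H, a = b ^ (1 / 2 : ℝ) * T * b ^ (1 / 2 : ℝ) := by
  have hr0 : 0 < r := by linarith
  have hle : a ^ r ≤ ‖R‖ • b ^ r := by
    have h1 := star_left_conjugate_le_conjugate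
      (IsSelfAdjoint.le_algebraMap_norm_self (IsSelfAdjoint.of_nonneg hR0)) (b ^ (r / 2))
    rw [(isSelfAdjoint_rpow b _).star_eq, ← hR, Algebra.algebraMap_eq_smul_one, mul_smul_comm,
      mul_one, smul_mul_assoc, half_rpow_mul_half_rpow hb hr0.le] at h1
    exact h1
  -- Löwner–Heinz; the exponent 1/r is at most 1 precisely because 1 ≤ r.
  have h2 := CFC.rpow_le_rpow (p := 1 / r)
    ⟨by positivity, by rw [div_le_one hr0]; exact hr⟩ hle
  rw [CFC.rpow_rpow_of_exponent_nonneg a _ _ hr0.le (by positivity) ha,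
    smul_rpow hb (norm_nonneg R) hr0 (by positivity), mul_one_div_cancel hr0.ne',
    CFC.rpow_one a ha, CFC.rpow_one b hb] at h2
  exact exists_eq_conj_of_le ha hb h2

/-- The Araki–Lieb–Thirring inequality in factorized form. -/
theorem trace_rpow_le_of_factorization {a b R T : H →L[ℂ] H} (ha : 0 ≤ a) (hb : 0 ≤ b) (hR0 : 0 ≤ R)
    (hT : 0 ≤ T) {r z : ℝ} (hr : 1 ≤ r) (hz : 0 < z) (hR : a ^ r = b ^ (r / 2) * R * b ^ (r / 2))
    (hTb : supp T ≤ supp b) (hTa : a = b ^ (1 / 2 : ℝ) * T * b ^ (1 / 2 : ℝ)) :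
    trace (T ^ (r * z)) ≤ trace (R ^ z) := by
  have hr0 : 0 < r := by linarith
  refine trace_le_of_compoundNorm_le CFC.rpow_nonneg CFC.rpow_nonneg fun k => ?_
  have hNR := compoundNorm_nonneg k R
  have hNRz := compoundNorm_nonneg k (R ^ z)
  calc compoundNorm k (T ^ (r * z)) ≤ compoundNorm k T ^ (r * z) :=
        compoundNorm_rpow_le k hT (by positivity)
    _ ≤ (compoundNorm k R ^ (1 / r)) ^ (r * z) :=
        Real.rpow_le_rpow (compoundNorm_nonneg k T)
          (compoundNorm_sandwich_le k ha hb hT hr hR hTb hTa) (by positivity)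
    _ = compoundNorm k R ^ z := by
        rw [← Real.rpow_mul hNR, one_div, inv_mul_cancel_left₀ hr0.ne']
    _ ≤ (compoundNorm k (R ^ z) ^ (1 / z)) ^ z := by
        have h1 := compoundNorm_rpow_le k (CFC.rpow_nonneg (a := R) (y := z))
          (one_div_nonneg.2 hz.le)
        rw [CFC.rpow_rpow_of_exponent_nonneg R _ _ hz.le (by positivity) hR0,
          mul_one_div_cancel hz.ne', CFC.rpow_one R hR0] at h1
        gcongr
    _ = compoundNorm k (R ^ z) := by
        rw [← Real.rpow_mul hNRz, one_div_mul_cancel hz.ne', Real.rpow_one]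

section

variable {α z z' : ℝ} {ρ σ : H →L[ℂ] H}

/-- Rewrites the factorization at z through the operators a and b attached to z', so that both
parameters can be compared: r = z'/z gives the equation for R, and r = 1 the one for T. -/
theorem factorizes_iff (hα : 1 < α) (hz' : 0 < z') (hρ : 0 ≤ ρ) (hσ : 0 ≤ σ) {r : ℝ} (hr : 0 < r)
    (hz : z' = r * z) (R : H →L[ℂ] H) :
    Factorizes α z ρ σ R ↔ (ρ ^ (α / z')) ^ r =
      (σ ^ ((α - 1) / z')) ^ (r / 2) * R * (σ ^ ((α - 1) / z')) ^ (r / 2) := by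
  have hz0 : z ≠ 0 := by rintro rfl; linarith
  have h1 : 0 ≤ α / z' := div_nonneg (by linarith) hz'.le
  have h2 : 0 ≤ (α - 1) / z' := div_nonneg (by linarith) hz'.le
  rw [CFC.rpow_rpow_of_exponent_nonneg ρ _ _ h1 hr.le hρ,
    CFC.rpow_rpow_of_exponent_nonneg σ _ _ h2 (by positivity) hσ]
  have e1 : α / z' * r = α / z := by rw [hz]; field_simp
  have e2 : (α - 1) / z' * (r / 2) = (α - 1) / (2 * z) := by rw [hz]; field_simp
  rw [e1, e2]
  rfl

theorem boundedSet_subset_and_trace_le (hα : 1 < α) (hz : 0 < z) (hzz' : z ≤ z')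
    (hσ : σ ∈ nonzeroPSD H) (hρ : ρ ∈ boundedSet α z σ) :
    ρ ∈ boundedSet α z' σ ∧
      trace (sandwich α z' ρ σ ^ z') ≤ trace (sandwich α z ρ σ ^ z) := by
  have hz' : 0 < z' := hz.trans_le hzz'
  have hρ0 : 0 ≤ ρ := hρ.1.1
  have hr : 1 ≤ z' / z := (one_le_div hz).2 hzz'
  have hr0 : 0 < z' / z := by positivity
  have e : z' = z' / z * z := (div_mul_cancel₀ z' hz.ne').symm
  obtain ⟨hR0, -, hR⟩ := sandwich_spec hα hz hσ hρ
  rw [factorizes_iff hα hz' hρ0 hσ.1 hr0 e] at hR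
  have hfac : ∀ T, Factorizes α z' ρ σ T ↔ ρ ^ (α / z') =
      (σ ^ ((α - 1) / z')) ^ (1 / 2 : ℝ) * T * (σ ^ ((α - 1) / z')) ^ (1 / 2 : ℝ) := by
    intro T
    rw [factorizes_iff hα hz' hρ0 hσ.1 one_pos (one_mul z').symm,
      CFC.rpow_one _ CFC.rpow_nonneg]
  have ha : 0 ≤ ρ ^ (α / z') := CFC.rpow_nonneg
  have hb : 0 ≤ σ ^ ((α - 1) / z') := CFC.rpow_nonneg
  have hmem : ρ ∈ boundedSet α z' σ := by
    obtain ⟨T, hT⟩ := exists_eq_conj_of_rpow ha hb hR0 hr hR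
    exact ⟨hρ.1, T, (hfac T).2 hT⟩
  refine ⟨hmem, ?_⟩
  obtain ⟨hT0, hTs, hT⟩ := sandwich_spec hα hz' hσ hmem
  rw [hfac] at hT
  have hs : supp (sandwich α z' ρ σ) ≤ supp (σ ^ ((α - 1) / z')) := by
    rw [supp_le_supp_iff] at hTs ⊢
    rwa [ker_rpow hσ.1 (div_pos (by linarith) hz')]
  have := trace_rpow_le_of_factorization ha hb hR0 hT0 hr hz hR hs hT
  rwa [← e] at this

theorem Q_antitoneOn (hα : 1 < α) (hσ : σ ∈ nonzeroPSD H) :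
    AntitoneOn (fun z : ℝ => Q α z ρ σ) (Set.Ioi 0) := by
  intro z hz z' _ hzz'
  by_cases h : ρ ∈ boundedSet α z σ
  · obtain ⟨h1, h2⟩ := boundedSet_subset_and_trace_le hα hz hzz' hσ h
    simpa only [Q, if_pos h, if_pos h1] using h2
  · simp only [Q, if_neg h, le_top]

theorem D_antitoneOn (hα : 1 < α) (hσ : σ ∈ nonzeroPSD H) :
    AntitoneOn (fun z : ℝ => D α z ρ σ) (Set.Ioi 0) := by
  intro z hz z' hz' hzz'
  have h0 : (0 : EReal) ≤ ((1 / (α - 1) : ℝ) : EReal) :=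
    EReal.coe_nonneg.2 (one_div_nonneg.2 (by linarith))
  exact mul_le_mul_of_nonneg_left (ENNReal.log_monotone (Q_antitoneOn hα hσ hz hz' hzz')) h0

end

end Monotonicity

end RenyiAZ

theorem mainTheorem9 {H : Type*} [NormedAddCommGroup H] [InnerProductSpace ℂ H]
    [CompleteSpace H] [TopologicalSpace.SeparableSpace H] (α : ℝ) (hα : 1 < α) :
    (∀ ρ ∈ RenyiAZ.nonzeroPSD H, ∀ σ ∈ RenyiAZ.nonzeroPSD H,
      AntitoneOn (fun z : ℝ => RenyiAZ.Q α z ρ σ) (Set.Ioi 0) ∧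
      AntitoneOn (fun z : ℝ => RenyiAZ.D α z ρ σ) (Set.Ioi 0) ∧
      (RenyiAZ.trace ρ < ⊤ →
        AntitoneOn (fun z : ℝ => RenyiAZ.Dtilde α z ρ σ) (Set.Ioi 0)) ∧
      RenyiAZ.Dsandwiched α ρ σ ≤ RenyiAZ.Dpetz α ρ σ) ∧
    (∀ σ ∈ RenyiAZ.nonzeroPSD H, ∀ z z' : ℝ, 0 < z → z ≤ z' →
      RenyiAZ.finiteSet α z σ ⊆ RenyiAZ.finiteSet α z' σ) := by
  refine ⟨fun ρ _ σ hσ => ?_, fun σ hσ z z' hz hzz' ρ hρ => ?_⟩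
  · have hD := RenyiAZ.D_antitoneOn (ρ := ρ) hα hσ
    refine ⟨RenyiAZ.Q_antitoneOn hα hσ, hD, fun _ z hz z' hz' hzz' => ?_, ?_⟩
    · exact EReal.sub_le_sub (hD hz hz' hzz') le_rfl
    · exact hD (Set.mem_Ioi.2 one_pos) (Set.mem_Ioi.2 (one_pos.trans hα)) hα.le
  · obtain ⟨h1, h2⟩ := RenyiAZ.boundedSet_subset_and_trace_le hα hz hzz' hσ hρ.1
    exact ⟨h1, h2.trans_lt hρ.2⟩
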